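/- For $n\ge 0$ let $P_n$ be a strictly convex polygon in the plane with $n+2$ vertices, one of whose edges $e_*$ is marked ($P_0$ is the degenerate polygon reduced to a double edge; it has exactly one triangulation, with no triangles). A triangulation of $P_n$ is a decomposition of $P_n$ into non-overlapping triangles whose vertices are vertices of $P_n$ (there are then necessarily $n$ triangles). A checkerboard triangulation of $P_n\supset e_*$ is a triangulation of $P_n$ whose triangles are coloured black and white in such a way that triangles sharing an edge have different colours and the triangle containing $e_*$ is black. Let $n_b(\tau)$ and $n_w(\tau)$ be the numbers of black and of white triangles of a checkerboard triangulation $\tau$, and put $$w_n(t)=\sum_{\tau}t^{\,n_b(\tau)-n_w(\tau)}\in\mathbb N[t,t^{-1}],$$ the sum being over all checkerboard triangulations $\tau$ of $P_n\supset e_*$. Then for every $n\ge 0$ $$w_{3n}(t)=\sum_{k=0}^n\binom{4n-2k}{n+k}\binom{2n+2k}{3k}\frac{t^{n-2k}}{3k+1},$$ $$w_{3n+1}(t)=\sum_{k=0}^n\binom{4n+2-2k}{n+k}\binom{2n+2k}{3k}\frac{t^{n+1-2k}}{2n+1-k},$$ $$w_{3n+2}(t)=\sum_{k=0}^n\binom{4n+2-2k}{n+1+k}\binom{2n+2+2k}{3k+1}\frac{t^{n-2k}}{3k+2}.$$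 (In particular $w_n$ does not depend on the choice of the polygon $P_n$ and of the marked edge $e_*$.) -/

import Mathlib

open scoped LaurentPolynomial

/-- Twice the signed area of the triangle `a b c`: positive exactly when `a, b, c` are the vertices
of a nondegenerate triangle in counterclockwise order. -/
def signedArea (a b c : EuclideanSpace ℝ (Fin 2)) : ℝ :=
  (b 0 - a 0) * (c 1 - a 1) - (b 1 - a 1) * (c 0 - a 0)

/-- A strictly convex polygon with `n + 2` vertices and a marked edge. The vertices are listed in
counterclockwise order, and the list starts at an end point of the marked edge, in such a way that
the marked edge joins the last vertex of the list to the first one.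
For `n = 0` this is the degenerate polygon reduced to a (double) edge. -/
structure MarkedPolygon (n : ℕ) where
  /-- The vertices. -/
  vertex : Fin (n + 2) → EuclideanSpace ℝ (Fin 2)
  vertex_injective : Function.Injective vertex
  counterclockwise : ∀ i j k : Fin (n + 2), i < j → j < k →
    0 < signedArea (vertex i) (vertex j) (vertex k)

namespace MarkedPolygon

variable {n : ℕ} (P : MarkedPolygon n)

/-- The closed convex region spanned by a set of vertices. -/
def region (S : Set (Fin (n + 2))) : Set (EuclideanSpace ℝ (Fin 2)) :=
  convexHull ℝ (P.vertex '' S)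

/-- A triangulation: a decomposition of the polygon into non-overlapping triangles whose vertices
are vertices of the polygon. A triangle is given by the set of (the indices of) its three vertices.
For `n = 0` there are no triangles, and the empty family is the unique triangulation. -/
structure IsTriangulation (τ : Finset (Finset (Fin (n + 2)))) : Prop where
  triangle : ∀ S ∈ τ, S.card = 3
  nonoverlapping : ∀ S ∈ τ, ∀ S' ∈ τ, S ≠ S' →
    Disjoint (interior (P.region S)) (interior (P.region S'))
  covers : n ≠ 0 → ⋃ S ∈ τ, P.region S = P.region Set.univ

/-- Two triangles are edge-adjacent if they are distinct and share an edge. -/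
def EdgeAdjacent (S S' : Finset (Fin (n + 2))) : Prop :=
  S ≠ S' ∧ (S ∩ S').card = 2

/-- `black` and `white` are the sets of black and of white triangles of a checkerboard
triangulation: together they form a triangulation, edge-adjacent triangles have different colours,
and the triangle that contains the marked edge is black. -/
structure IsCheckerboard (black white : Finset (Finset (Fin (n + 2)))) : Prop where
  triangulation : P.IsTriangulation (black ∪ white)
  disjoint : Disjoint black white
  black_not_adjacent : ∀ S ∈ black, ∀ S' ∈ black, ¬ EdgeAdjacent S S'
  white_not_adjacent : ∀ S ∈ white, ∀ S' ∈ white, ¬ EdgeAdjacent S S'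
  marked_black : ∀ S ∈ black ∪ white, 0 ∈ S → Fin.last (n + 1) ∈ S → S ∈ black

open Classical in
/-- The finite set of all checkerboard triangulations, as pairs (black triangles, white
triangles). -/
noncomputable def checkerboardTriangulations :
    Finset (Finset (Finset (Fin (n + 2))) × Finset (Finset (Fin (n + 2)))) :=
  Finset.univ.filter fun c => P.IsCheckerboard c.1 c.2

/-- The Laurent polynomial `∑ t ^ (n_b - n_w)`, the sum being over all checkerboard triangulations,
where `n_b` and `n_w` are the numbers of black and of white triangles. -/
noncomputable def windingPolynomial : ℕ[T;T⁻¹] :=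
  ∑ c ∈ P.checkerboardTriangulations, LaurentPolynomial.T ((c.1.card : ℤ) - (c.2.card : ℤ))

end MarkedPolygon

/-! The triangle at the marked edge cuts the polygon into two smaller polygons, each marked by the
side it shares with that triangle. The triangle is black, so both pieces are checkerboard with the
colours exchanged, which replaces `t` by `t⁻¹`. Hence `w (n + 1) = t * ∑ i, w̄ i * w̄ (n - i)`,
where the bar is `t ↦ t⁻¹`.

For `F = ∑ w n * x ^ n - 1` this reads `F = x t (1 + F̄) ^ 2`. With `y = x t`, `z = x t⁻¹`, `u = F`
and `v = F̄` it is the symmetric system `u = y (1 + v) ^ 2`, `v = z (1 + u) ^ 2`. Its Lagrange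
formula gives `k / p * (2 p).choose q * (2 q).choose (p - k)` as coefficient of `y ^ p z ^ q` in `u
^ k`. This is checked by induction on the degree for all powers at once: the relation between `u ^
k` and the powers of `v` reduces to Vandermonde's identity (`lagrangeCoeff_eq_sum`,
`coeff_pow_of_functional_equation`). The case `k = 1` counts by colour. The count vanishes unless `q
≤ 2 p` and `p ≤ 2 q + 1`, and the three residues of `p + q` modulo 3 give the three formulas.

The geometric input is that covering and nonoverlapping are compatible with the cut. The sign of
`signedArea` tells the sides of a chord, two triangles with crossing edges overlap, and convex hulls
can be cut along chords. This yields `exists_triangle_mem`, `subset_or_subset` and `glue`, from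
which `weightBetween_eq_sum` draws the recursion. -/

/-! ### Plane geometry of the signed area -/

open Filter Topology in
/-- If all points of the open segment from `x` to `c` near `x` lie in a closed set, so does `x`. -/
theorem mem_of_isClosed_of_lineMap_mem {E : Type*} [NormedAddCommGroup E] [NormedSpace ℝ E]
    {K : Set E} (hK : IsClosed K) {x c : E}
    (h : ∀ ε : ℝ, 0 < ε → ε ≤ 1 → AffineMap.lineMap x c ε ∈ K) : x ∈ K := by
  have hc : Tendsto (fun ε : ℝ => AffineMap.lineMap x c ε) (𝓝[>] 0) (𝓝 x) := by
    have : Continuous (fun ε : ℝ => AffineMap.lineMap x c ε) := AffineMap.lineMap_continuous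
    have h0 := this.tendsto 0
    rw [AffineMap.lineMap_apply_zero] at h0
    exact h0.mono_left nhdsWithin_le_nhds
  refine hK.mem_of_tendsto hc ?_
  filter_upwards [Ioc_mem_nhdsGT (zero_lt_one (α := ℝ))] with ε hε using h ε hε.1 hε.2

theorem signedArea_lineMap (a b x y : EuclideanSpace ℝ (Fin 2)) (ε : ℝ) :
    signedArea a b (AffineMap.lineMap x y ε) =
      (1 - ε) * signedArea a b x + ε * signedArea a b y := by
  simp [signedArea, AffineMap.lineMap_apply]
  ring

theorem signedArea_combination (a b x y : EuclideanSpace ℝ (Fin 2)) {s t : ℝ} (h : s + t = 1) :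
    signedArea a b (s • x + t • y) = s * signedArea a b x + t * signedArea a b y := by
  obtain rfl : t = 1 - s := by linarith
  simp [signedArea]
  ring

theorem signedArea_rotate (a b c : EuclideanSpace ℝ (Fin 2)) :
    signedArea a b c = signedArea b c a := by
  simp only [signedArea]
  ring

theorem signedArea_swap (a b c : EuclideanSpace ℝ (Fin 2)) :
    signedArea a c b = -signedArea a b c := by
  simp only [signedArea]
  ring

@[simp] theorem signedArea_left (a b : EuclideanSpace ℝ (Fin 2)) : signedArea a b a = 0 := by
  simp [signedArea]

@[simp] theorem signedArea_right (a b : EuclideanSpace ℝ (Fin 2)) : signedArea a b b = 0 := by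
  simp [signedArea, mul_comm]

theorem continuous_signedArea (a b : EuclideanSpace ℝ (Fin 2)) : Continuous (signedArea a b) := by
  unfold signedArea
  fun_prop

theorem convex_signedArea_nonneg (a b : EuclideanSpace ℝ (Fin 2)) :
    Convex ℝ {x | 0 ≤ signedArea a b x} := by
  intro x hx y hy s t hs ht hst
  simp only [Set.mem_ofPred_eq] at *
  rw [signedArea_combination a b x y hst]
  positivity

theorem convex_signedArea_nonpos (a b : EuclideanSpace ℝ (Fin 2)) :
    Convex ℝ {x | signedArea a b x ≤ 0} := by
  intro x hx y hy s t hs ht hst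
  simp only [Set.mem_ofPred_eq] at *
  rw [signedArea_combination a b x y hst]
  nlinarith

-- Near a common interior point the area would vanish identically, but it becomes nonzero as soon as
-- the point moves towards `c`.
open Filter Topology in
theorem disjoint_interior_of_signedArea {a b c : EuclideanSpace ℝ (Fin 2)}
    (hc : signedArea a b c ≠ 0) {X Y : Set (EuclideanSpace ℝ (Fin 2))}
    (hX : ∀ x ∈ X, signedArea a b x ≤ 0) (hY : ∀ y ∈ Y, 0 ≤ signedArea a b y) :
    Disjoint (interior X) (interior Y) := by
  rw [Set.disjoint_left]
  intro z hzX hzY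
  have hz : ∀ᶠ x in 𝓝 z, signedArea a b x = 0 := by
    filter_upwards [isOpen_interior.mem_nhds hzX, isOpen_interior.mem_nhds hzY] with x h1 h2
    exact le_antisymm (hX x (interior_subset h1)) (hY x (interior_subset h2))
  have hz0 := hz.self_of_nhds
  have ht : Tendsto (fun ε : ℝ => AffineMap.lineMap z c ε) (𝓝[>] 0) (𝓝 z) := by
    have : Continuous (fun ε : ℝ => AffineMap.lineMap z c ε) := AffineMap.lineMap_continuous
    have h0 := this.tendsto 0
    rw [AffineMap.lineMap_apply_zero] at h0
    exact h0.mono_left nhdsWithin_le_nhds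
  obtain ⟨ε, hε, hpos⟩ := ((ht.eventually hz).and self_mem_nhdsWithin).exists
  rw [signedArea_lineMap, hz0] at hε
  have hpos' : ε ≠ 0 := ne_of_gt hpos
  simp [hc, hpos'] at hε

/-- The ratios of the areas seen from `x` to the total area are the barycentric coordinates of `x`.
So the open set where all three areas are positive lies in `X`, and it contains the centroid. -/
theorem interior_triangle_nonempty {a b c : EuclideanSpace ℝ (Fin 2)} (h : 0 < signedArea a b c)
    {X : Set (EuclideanSpace ℝ (Fin 2))} (hX : Convex ℝ X) (ha : a ∈ X) (hb : b ∈ X)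
    (hc : c ∈ X) : (interior X).Nonempty := by
  let U := {x | 0 < signedArea a b x} ∩ {x | 0 < signedArea b c x} ∩ {x | 0 < signedArea c a x}
  have hU : IsOpen U :=
    (((isOpen_lt continuous_const (continuous_signedArea a b)).inter
      (isOpen_lt continuous_const (continuous_signedArea b c))).inter
      (isOpen_lt continuous_const (continuous_signedArea c a)))
  have hUX : U ⊆ X := by
    rintro x ⟨⟨h1, h2⟩, h3⟩
    simp only [Set.mem_ofPred_eq] at h1 h2 h3
    have hx : x = (signedArea b c x / signedArea a b c) • a +
        (signedArea c a x / signedArea a b c) • b +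
        (signedArea a b x / signedArea a b c) • c := by
      ext i
      simp only [PiLp.add_apply, PiLp.smul_apply, smul_eq_mul]
      field_simp
      fin_cases i <;> simp [signedArea] <;> ring
    have hs : signedArea b c x / signedArea a b c + signedArea c a x / signedArea a b c +
        signedArea a b x / signedArea a b c = 1 := by
      field_simp
      simp only [signedArea]
      ring
    rw [hx]
    have := hX.sum_mem (t := Finset.univ)
      (w := ![signedArea b c x / signedArea a b c, signedArea c a x / signedArea a b c,
        signedArea a b x / signedArea a b c]) (z := ![a, b, c])
      (by intro i _; fin_cases i <;> simp <;> positivity)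
      (by simpa [Fin.sum_univ_three] using hs)
      (by intro i _; fin_cases i <;> simp <;> assumption)
    simpa [Fin.sum_univ_three] using this
  refine ⟨(1 / 3 : ℝ) • a + (1 / 3 : ℝ) • b + (1 / 3 : ℝ) • c, interior_maximal hUX hU ?_⟩
  have e1 : signedArea a b ((1 / 3 : ℝ) • a + (1 / 3 : ℝ) • b + (1 / 3 : ℝ) • c) =
      signedArea a b c / 3 := by simp [signedArea]; ring
  have e2 : signedArea b c ((1 / 3 : ℝ) • a + (1 / 3 : ℝ) • b + (1 / 3 : ℝ) • c) =
      signedArea a b c / 3 := by simp [signedArea]; ring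
  have e3 : signedArea c a ((1 / 3 : ℝ) • a + (1 / 3 : ℝ) • b + (1 / 3 : ℝ) • c) =
      signedArea a b c / 3 := by simp [signedArea]; ring
  refine ⟨⟨?_, ?_⟩, ?_⟩
  · rw [Set.mem_ofPred_eq, e1]; positivity
  · rw [Set.mem_ofPred_eq, e2]; positivity
  · rw [Set.mem_ofPred_eq, e3]; positivity

/-- Two convex sets with nonempty interior overlap as soon as they contain the two diagonals of a
strictly convex quadrilateral `a b c d`. -/
theorem not_disjoint_interior_of_crossing {a b c d : EuclideanSpace ℝ (Fin 2)}
    (habc : 0 < signedArea a b c) (habd : 0 < signedArea a b d) (hacd : 0 < signedArea a c d)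
    (hbcd : 0 < signedArea b c d) {X Y : Set (EuclideanSpace ℝ (Fin 2))}
    (hX : Convex ℝ X) (hY : Convex ℝ Y) (hX' : (interior X).Nonempty)
    (hY' : (interior Y).Nonempty) (ha : a ∈ X) (hc : c ∈ X) (hb : b ∈ Y) (hd : d ∈ Y) :
    ¬ Disjoint (interior X) (interior Y) := by
  intro hdis
  obtain ⟨f, u, hfX, hfY⟩ := geometric_hahn_banach_open_open hX.interior isOpen_interior
    hY.interior isOpen_interior hdis
  have hleX : ∀ x ∈ X, f x ≤ u := by
    intro x hx
    have : x ∈ closure (interior X) := by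
      rw [hX.closure_interior_eq_closure_of_nonempty_interior hX']
      exact subset_closure hx
    exact closure_minimal (fun y hy => (hfX y hy).le) (isClosed_le f.continuous continuous_const)
      this
  have hleY : ∀ x ∈ Y, u ≤ f x := by
    intro x hx
    have : x ∈ closure (interior Y) := by
      rw [hY.closure_interior_eq_closure_of_nonempty_interior hY']
      exact subset_closure hx
    exact closure_minimal (fun y hy => (hfY y hy).le) (isClosed_le continuous_const f.continuous)
      this
  have hf : ∀ x, f x = x 0 * f (EuclideanSpace.single 0 1) + x 1 * f (EuclideanSpace.single 1 1) := by
    intro x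
    have : x = x 0 • EuclideanSpace.single 0 1 + x 1 • EuclideanSpace.single 1 1 := by
      ext i
      fin_cases i <;> simp
    conv_lhs => rw [this]
    simp
  have h1 := hleX a ha
  have h2 := hleX c hc
  have h3 := hleY b hb
  have h4 := hleY d hd
  -- The four areas are the weights of the affine dependence `bcd • a + abd • c = acd • b + abc •
  -- d`, which expresses that the diagonals meet. All four terms below are nonnegative, hence zero.
  have key : signedArea b c d * (u - f a) + signedArea a b d * (u - f c) +
      signedArea a c d * (f b - u) + signedArea a b c * (f d - u) = 0 := by
    rw [hf a, hf b, hf c, hf d]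
    simp only [signedArea]
    ring
  have p1 := mul_nonneg hbcd.le (sub_nonneg.2 h1)
  have p2 := mul_nonneg habd.le (sub_nonneg.2 h2)
  have p3 := mul_nonneg hacd.le (sub_nonneg.2 h3)
  have p4 := mul_nonneg habc.le (sub_nonneg.2 h4)
  have q1 : u - f a = 0 := by
    have : signedArea b c d * (u - f a) = 0 := by linarith
    simpa [hbcd.ne'] using this
  have q2 : u - f c = 0 := by
    have : signedArea a b d * (u - f c) = 0 := by linarith
    simpa [habd.ne'] using this
  have q3 : f b - u = 0 := by
    have : signedArea a c d * (f b - u) = 0 := by linarith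
    simpa [hacd.ne'] using this
  -- `f` is constant on the nondegenerate triangle `a b c`, so it is zero, which contradicts the
  -- strict separation of the interiors.
  set α := f (EuclideanSpace.single 0 1)
  set β := f (EuclideanSpace.single 1 1)
  have e1 : (b 0 - a 0) * α + (b 1 - a 1) * β = 0 := by
    have := hf a; have := hf b; linarith
  have e2 : (c 0 - a 0) * α + (c 1 - a 1) * β = 0 := by
    have := hf a; have := hf c; linarith
  have hα : α = 0 := by
    have : signedArea a b c * α = 0 := by
      simp only [signedArea]
      linear_combination (c 1 - a 1) * e1 - (b 1 - a 1) * e2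
    simpa [habc.ne'] using this
  have hβ : β = 0 := by
    have : signedArea a b c * β = 0 := by
      simp only [signedArea]
      linear_combination -(c 0 - a 0) * e1 + (b 0 - a 0) * e2
    simpa [habc.ne'] using this
  obtain ⟨x, hx⟩ := hX'
  obtain ⟨y, hy⟩ := hY'
  have hx' := hfX x hx
  have hy' := hfY y hy
  rw [hf, hα, hβ] at hx' hy'
  linarith

/-- A point on the line `a b` that lies between two supporting lines at `a` and `b` lies on the
segment. -/
theorem mem_segment_of_signedArea {a b c d m : EuclideanSpace ℝ (Fin 2)}
    (hm : signedArea a b m = 0) (hc : 0 < signedArea c a b) (hcm : 0 ≤ signedArea c a m)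
    (hd : 0 < signedArea b d a) (hdm : 0 ≤ signedArea b d m) : m ∈ segment ℝ a b := by
  -- The area over `c a` vanishes at `a` and is linear along the line, so this ratio is the position
  -- of `m`. The support at `a` gives `0 ≤ r`, the one at `b` gives `r ≤ 1`.
  set r := signedArea c a m / signedArea c a b with hr
  have hmr : m = AffineMap.lineMap a b r := by
    have h0 : (m 0 - a 0) * signedArea c a b = signedArea c a m * (b 0 - a 0) := by
      simp only [signedArea] at *
      linear_combination (-(a 0 - c 0)) * hm
    have h1 : (m 1 - a 1) * signedArea c a b = signedArea c a m * (b 1 - a 1) := by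
      simp only [signedArea] at *
      linear_combination (-(a 1 - c 1)) * hm
    ext i
    fin_cases i
    · simp only [Fin.zero_eta, AffineMap.lineMap_apply, vsub_eq_sub, vadd_eq_add, PiLp.add_apply,
        PiLp.smul_apply, PiLp.sub_apply, smul_eq_mul, hr]
      field_simp
      linarith
    · simp only [Fin.mk_one, AffineMap.lineMap_apply, vsub_eq_sub, vadd_eq_add, PiLp.add_apply,
        PiLp.smul_apply, PiLp.sub_apply, smul_eq_mul, hr]
      field_simp
      linarith
  rw [segment_eq_image_lineMap]
  refine ⟨r, ⟨by positivity, ?_⟩, hmr.symm⟩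
  rw [hmr, signedArea_lineMap, signedArea_left] at hdm
  by_contra! h
  nlinarith

/-- Cutting the convex hull of `X ∪ Y` along the line `a b`. -/
theorem convexHull_union_subset {a b c d : EuclideanSpace ℝ (Fin 2)}
    {X Y : Set (EuclideanSpace ℝ (Fin 2))} (haX : a ∈ X) (hbX : b ∈ X) (haY : a ∈ Y)
    (hbY : b ∈ Y) (hX : ∀ x ∈ X, signedArea a b x ≤ 0) (hY : ∀ y ∈ Y, 0 ≤ signedArea a b y)
    (hc : 0 < signedArea c a b) (hcXY : ∀ x ∈ X ∪ Y, 0 ≤ signedArea c a x)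
    (hd : 0 < signedArea b d a) (hdXY : ∀ x ∈ X ∪ Y, 0 ≤ signedArea b d x) :
    convexHull ℝ (X ∪ Y) ⊆ convexHull ℝ X ∪ convexHull ℝ Y := by
  -- The supporting lines at `a` and `b` force the hull to meet the line `a b` only in the segment,
  -- which belongs to both halves.
  have hcut : ∀ m ∈ convexHull ℝ (X ∪ Y), signedArea a b m = 0 →
      m ∈ convexHull ℝ X ∧ m ∈ convexHull ℝ Y := by
    intro m hm hm0
    have := mem_segment_of_signedArea hm0 hc
      (convexHull_min hcXY (convex_signedArea_nonneg c a) hm) hd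
      (convexHull_min hdXY (convex_signedArea_nonneg b d) hm)
    exact ⟨segment_subset_convexHull haX hbX this, segment_subset_convexHull haY hbY this⟩
  have hivt : ∀ x y : EuclideanSpace ℝ (Fin 2), signedArea a b x ≤ 0 → 0 ≤ signedArea a b y →
      ∃ m ∈ segment ℝ x y, signedArea a b m = 0 := by
    intro x y hx hy
    have := (convex_segment x y).isPreconnected.intermediate_value (left_mem_segment ℝ x y)
      (right_mem_segment ℝ x y) (continuous_signedArea a b).continuousOn ⟨hx, hy⟩
    exact this
  intro x hx
  rw [convexHull_union ⟨a, haX⟩ ⟨a, haY⟩, mem_convexJoin] at hx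
  obtain ⟨p, hp, q, hq, hx⟩ := hx
  have hp0 : signedArea a b p ≤ 0 := convexHull_min hX (convex_signedArea_nonpos a b) hp
  have hq0 : 0 ≤ signedArea a b q := convexHull_min hY (convex_signedArea_nonneg a b) hq
  have hp' : p ∈ convexHull ℝ (X ∪ Y) := convexHull_mono Set.subset_union_left hp
  have hq' : q ∈ convexHull ℝ (X ∪ Y) := convexHull_mono Set.subset_union_right hq
  have hx' : x ∈ convexHull ℝ (X ∪ Y) := (convex_convexHull ℝ _).segment_subset hp' hq' hx
  -- The segment from `p` to `q` through `x` crosses the line at some `m`, and `x` lies between `m`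
  -- and the end point on its own side.
  rcases le_total (signedArea a b x) 0 with h | h
  · obtain ⟨m, hm, hm0⟩ := hivt x q h hq0
    have hm1 := hcut m ((convex_convexHull ℝ _).segment_subset hx' hq' hm) hm0
    left
    refine (convex_convexHull ℝ X).segment_subset hp hm1.1 ?_
    rw [mem_segment_iff_wbtw] at *
    exact hx.trans_right_left hm
  · obtain ⟨m, hm, hm0⟩ := hivt p x hp0 h
    have hm1 := hcut m ((convex_convexHull ℝ _).segment_subset hp' hx' hm) hm0
    right
    refine (convex_convexHull ℝ Y).segment_subset hm1.2 hq ?_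
    rw [mem_segment_iff_wbtw] at *
    exact hx.trans_left_right hm

/-! ### Chords, regions and triangulations of a convex polygon -/

namespace MarkedPolygon

variable {n : ℕ} (P : MarkedPolygon n)

theorem signedArea_chord_neg {i j k : Fin (n + 2)} (hik : i < k) (hkj : k < j) :
    signedArea (P.vertex i) (P.vertex j) (P.vertex k) < 0 := by
  rw [signedArea_swap]
  linarith [P.counterclockwise i k j hik hkj]

theorem signedArea_chord_nonpos {i j k : Fin (n + 2)} (hik : i ≤ k) (hkj : k ≤ j) :
    signedArea (P.vertex i) (P.vertex j) (P.vertex k) ≤ 0 := by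
  rcases hik.eq_or_lt with rfl | hik
  · simp
  rcases hkj.eq_or_lt with rfl | hkj
  · simp
  exact (P.signedArea_chord_neg hik hkj).le

theorem signedArea_chord_pos {i j k : Fin (n + 2)} (hij : i < j) (hk : k < i ∨ j < k) :
    0 < signedArea (P.vertex i) (P.vertex j) (P.vertex k) := by
  rcases hk with hk | hk
  · rw [← signedArea_rotate]
    exact P.counterclockwise k i j hk hij
  · exact P.counterclockwise i j k hij hk

theorem signedArea_chord_nonneg {i j k : Fin (n + 2)} (hij : i < j) (hk : k ≤ i ∨ j ≤ k) :
    0 ≤ signedArea (P.vertex i) (P.vertex j) (P.vertex k) := by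
  rcases hk with hk | hk
  · rcases hk.eq_or_lt with rfl | hk
    · simp
    · exact (P.signedArea_chord_pos hij (.inl hk)).le
  · rcases hk.eq_or_lt with rfl | hk
    · simp
    · exact (P.signedArea_chord_pos hij (.inr hk)).le

theorem vertex_mem_region {S : Set (Fin (n + 2))} {i : Fin (n + 2)} (hi : i ∈ S) :
    P.vertex i ∈ P.region S :=
  subset_convexHull ℝ _ (Set.mem_image_of_mem _ hi)

theorem convex_region (S : Set (Fin (n + 2))) : Convex ℝ (P.region S) :=
  convex_convexHull ℝ _

theorem region_mono {S S' : Set (Fin (n + 2))} (h : S ⊆ S') : P.region S ⊆ P.region S' :=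
  convexHull_mono (Set.image_mono h)

theorem isClosed_region (S : Set (Fin (n + 2))) : IsClosed (P.region S) :=
  ((Set.toFinite S).image _).isClosed_convexHull ℝ

theorem signedArea_nonpos_of_mem_region {i j : Fin (n + 2)} {S : Set (Fin (n + 2))}
    (hS : ∀ k ∈ S, i ≤ k ∧ k ≤ j) {x : EuclideanSpace ℝ (Fin 2)} (hx : x ∈ P.region S) :
    signedArea (P.vertex i) (P.vertex j) x ≤ 0 := by
  refine convexHull_min (t := {x | signedArea (P.vertex i) (P.vertex j) x ≤ 0}) ?_
    (convex_signedArea_nonpos _ _) hx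
  rintro _ ⟨k, hk, rfl⟩
  exact P.signedArea_chord_nonpos (hS k hk).1 (hS k hk).2

theorem signedArea_nonneg_of_mem_region {i j : Fin (n + 2)} (hij : i < j) {S : Set (Fin (n + 2))}
    (hS : ∀ k ∈ S, k ≤ i ∨ j ≤ k) {x : EuclideanSpace ℝ (Fin 2)} (hx : x ∈ P.region S) :
    0 ≤ signedArea (P.vertex i) (P.vertex j) x := by
  refine convexHull_min (t := {x | 0 ≤ signedArea (P.vertex i) (P.vertex j) x}) ?_
    (convex_signedArea_nonneg _ _) hx
  rintro _ ⟨k, hk, rfl⟩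
  exact P.signedArea_chord_nonneg hij (hS k hk)

/-- Regions on different sides of a chord do not overlap. -/
theorem disjoint_interior_region {i j m : Fin (n + 2)} (hij : i < j) (hm : m < i ∨ j < m)
    {S S' : Set (Fin (n + 2))} (hS : ∀ k ∈ S, i ≤ k ∧ k ≤ j) (hS' : ∀ k ∈ S', k ≤ i ∨ j ≤ k) :
    Disjoint (interior (P.region S)) (interior (P.region S')) :=
  disjoint_interior_of_signedArea (P.signedArea_chord_pos hij hm).ne'
    (fun _ hx => P.signedArea_nonpos_of_mem_region hS hx)
    (fun _ hx => P.signedArea_nonneg_of_mem_region hij hS' hx)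

theorem interior_region_nonempty {S : Finset (Fin (n + 2))} (hS : S.card = 3) :
    (interior (P.region S)).Nonempty := by
  have hmem : ∀ i, P.vertex (S.orderEmbOfFin hS i) ∈ P.region S := fun i =>
    P.vertex_mem_region (Finset.mem_coe.2 (S.orderEmbOfFin_mem hS i))
  have hlt : ∀ i j, i < j → S.orderEmbOfFin hS i < S.orderEmbOfFin hS j := fun i j h =>
    (S.orderEmbOfFin hS).strictMono h
  exact interior_triangle_nonempty
    (P.counterclockwise _ _ _ (hlt 0 1 (by decide)) (hlt 1 2 (by decide)))
    (P.convex_region S) (hmem 0) (hmem 1) (hmem 2)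

/-- Triangles with crossing edges overlap. -/
theorem not_disjoint_interior_region {S S' : Finset (Fin (n + 2))} (hS : S.card = 3)
    (hS' : S'.card = 3) {i j k l : Fin (n + 2)} (hij : i < j) (hjk : j < k) (hkl : k < l)
    (hi : i ∈ S) (hk : k ∈ S) (hj : j ∈ S') (hl : l ∈ S') :
    ¬ Disjoint (interior (P.region S)) (interior (P.region S')) :=
  not_disjoint_interior_of_crossing (P.counterclockwise i j k hij hjk)
    (P.counterclockwise i j l hij (hjk.trans hkl)) (P.counterclockwise i k l (hij.trans hjk) hkl)
    (P.counterclockwise j k l hjk hkl) (P.convex_region S) (P.convex_region S')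
    (P.interior_region_nonempty hS) (P.interior_region_nonempty hS')
    (P.vertex_mem_region hi) (P.vertex_mem_region hk) (P.vertex_mem_region hj)
    (P.vertex_mem_region hl)

/-- A convex polygon is cut by the diagonals from an inner vertex `j` to the end points of the
marked edge into a triangle and two convex polygons. -/
theorem region_Icc_subset {a j b : Fin (n + 2)} (haj : a < j) (hjb : j < b) :
    P.region (Set.Icc a b) ⊆
      P.region (Set.Icc a j) ∪ (P.region {a, j, b} ∪ P.region (Set.Icc j b)) := by
  have h1 : P.region (Set.Icc a b) ⊆
      P.region (Set.Icc a j) ∪ P.region (insert a (Set.Icc j b)) := by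
    have hun : Set.Icc a b = Set.Icc a j ∪ insert a (Set.Icc j b) := by
      ext k
      simp only [Set.mem_Icc, Set.mem_union, Set.mem_insert_iff]
      omega
    have hj' : j.val + 1 < n + 2 := by omega
    have hlt : j < ⟨j.val + 1, hj'⟩ := by simp [Fin.lt_def]
    rw [hun]
    unfold region
    rw [Set.image_union]
    -- The supporting lines are `b a` at `a`, and at `j` the polygon edge from `j` to `j + 1`.
    refine convexHull_union_subset (a := P.vertex a) (b := P.vertex j) (c := P.vertex b)
      (d := P.vertex ⟨j.val + 1, hj'⟩) ⟨a, by simp [haj.le], rfl⟩ ⟨j, by simp [haj.le], rfl⟩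
      ⟨a, by simp, rfl⟩ ⟨j, by simp [hjb.le], rfl⟩ ?_ ?_ ?_ ?_ ?_ ?_
    · rintro _ ⟨k, hk, rfl⟩
      exact P.signedArea_chord_nonpos hk.1 hk.2
    · rintro _ ⟨k, hk, rfl⟩
      refine P.signedArea_chord_nonneg haj ?_
      rcases hk with rfl | hk
      · exact .inl le_rfl
      · exact .inr hk.1
    · rw [signedArea_rotate]
      exact P.counterclockwise a j b haj hjb
    · rw [← Set.image_union, ← hun]
      rintro _ ⟨k, hk, rfl⟩
      rw [signedArea_rotate, signedArea_swap]
      linarith [P.signedArea_chord_nonpos hk.1 hk.2]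
    · exact P.signedArea_chord_pos hlt (.inl haj)
    · rw [← Set.image_union]
      rintro _ ⟨k, hk, rfl⟩
      refine P.signedArea_chord_nonneg hlt ?_
      simp only [Fin.le_def]
      omega
  have h2 : P.region (insert a (Set.Icc j b)) ⊆
      P.region (Set.Icc j b) ∪ P.region {a, j, b} := by
    have hun : insert a (Set.Icc j b) = Set.Icc j b ∪ {a, j, b} := by
      ext k
      simp only [Set.mem_Icc, Set.mem_union, Set.mem_insert_iff, Set.mem_singleton_iff]
      omega
    rw [hun]
    unfold region
    rw [Set.image_union]
    refine convexHull_union_subset (a := P.vertex j) (b := P.vertex b) (c := P.vertex a)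
      (d := P.vertex a) ⟨j, by simp [hjb.le], rfl⟩ ⟨b, by simp [hjb.le], rfl⟩
      ⟨j, by simp, rfl⟩ ⟨b, by simp, rfl⟩ ?_ ?_ ?_ ?_ ?_ ?_
    · rintro _ ⟨k, hk, rfl⟩
      exact P.signedArea_chord_nonpos hk.1 hk.2
    · rintro _ ⟨k, hk, rfl⟩
      refine P.signedArea_chord_nonneg hjb ?_
      simp only [Set.mem_insert_iff, Set.mem_singleton_iff] at hk
      omega
    · exact P.counterclockwise a j b haj hjb
    · rw [← Set.image_union, ← hun]
      rintro _ ⟨k, hk, rfl⟩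
      refine P.signedArea_chord_nonneg haj ?_
      simp only [Set.mem_insert_iff, Set.mem_Icc] at hk
      omega
    · rw [signedArea_rotate]
      exact P.counterclockwise a j b haj hjb
    · rw [← Set.image_union, ← hun]
      rintro _ ⟨k, hk, rfl⟩
      rw [signedArea_rotate, signedArea_swap]
      simp only [Set.mem_insert_iff, Set.mem_Icc] at hk
      linarith [P.signedArea_chord_nonpos (i := a) (j := b) (k := k) (by omega) (by omega)]
  intro x hx
  rcases h1 hx with hx | hx
  · exact .inl hx
  · rcases h2 hx with hx | hx
    · exact .inr (.inr hx)
    · exact .inr (.inl hx)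

/-- If a family of regions covers the part of the polygon cut off by a chord, and no member crosses
the chord, then the members inside that part cover it. -/
theorem iUnion_region_filter_eq {i j m : Fin (n + 2)} (him : i < m) (hmj : m < j)
    {τ : Finset (Finset (Fin (n + 2)))}
    (hcov : P.region (Set.Icc i j) ⊆ ⋃ S ∈ τ, P.region S)
    (hτ : ∀ S ∈ τ, S ⊆ Finset.Icc i j ∨ ∀ k ∈ S, k ≤ i ∨ j ≤ k) :
    ⋃ S ∈ τ.filter (· ⊆ Finset.Icc i j), P.region S = P.region (Set.Icc i j) := by
  refine subset_antisymm (Set.iUnion₂_subset fun S hS => P.region_mono ?_) fun x hx => ?_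
  · rw [← Finset.coe_Icc]
    exact_mod_cast (Finset.mem_filter.1 hS).2
  -- A point on the chord might be covered from the far side only. Pushed towards `m` it lies
  -- strictly inside, where only members of the filtered family can cover it, and the union of these
  -- is closed.
  refine mem_of_isClosed_of_lineMap_mem (c := P.vertex m)
    (isClosed_biUnion_finset (f := fun S : Finset (Fin (n + 2)) => P.region S)
      fun S _ => P.isClosed_region S) fun ε h0 h1 => ?_
  have hxm : AffineMap.lineMap x (P.vertex m) ε ∈ P.region (Set.Icc i j) :=
    (P.convex_region _).lineMap_mem hx (P.vertex_mem_region ⟨him.le, hmj.le⟩) ⟨h0.le, h1⟩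
  have hneg : signedArea (P.vertex i) (P.vertex j) (AffineMap.lineMap x (P.vertex m) ε) < 0 := by
    rw [signedArea_lineMap]
    have e1 := P.signedArea_nonpos_of_mem_region (i := i) (j := j) (fun k hk => hk) hx
    have e2 := P.signedArea_chord_neg him hmj
    nlinarith
  obtain ⟨S, hS, hxS⟩ := Set.mem_iUnion₂.1 (hcov hxm)
  refine Set.mem_iUnion₂.2 ⟨S, Finset.mem_filter.2 ⟨hS, ?_⟩, hxS⟩
  refine (hτ S hS).resolve_right fun h => ?_
  exact absurd (P.signedArea_nonneg_of_mem_region (him.trans hmj) h hxS) (not_le.2 hneg)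

/-- A triangulation of the convex polygon spanned by the vertices from `a` to `b`. -/
structure IsTriangulationBetween (a b : Fin (n + 2)) (τ : Finset (Finset (Fin (n + 2)))) :
    Prop where
  triangle : ∀ S ∈ τ, S.card = 3
  subset_Icc : ∀ S ∈ τ, S ⊆ Finset.Icc a b
  nonoverlapping : ∀ S ∈ τ, ∀ S' ∈ τ, S ≠ S' →
    Disjoint (interior (P.region S)) (interior (P.region S'))
  covers : a.val + 1 ≠ b.val → ⋃ S ∈ τ, P.region S = P.region (Set.Icc a b)

namespace IsTriangulationBetween

variable {P} {a b j : Fin (n + 2)} {τ : Finset (Finset (Fin (n + 2)))}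

theorem mem_Icc (h : P.IsTriangulationBetween a b τ) {S : Finset (Fin (n + 2))} (hS : S ∈ τ)
    {k : Fin (n + 2)} (hk : k ∈ S) : a ≤ k ∧ k ≤ b :=
  Finset.mem_Icc.1 (h.subset_Icc S hS hk)

/-- Some triangle contains the midpoint of the edge `a b`. If it missed `a`, it would lie beyond the
chord from `a + 1` to `b`, which strictly separates it from the midpoint; likewise for `b`. -/
theorem exists_triangle_mem (h : P.IsTriangulationBetween a b τ) (hab : a < b)
    (hab' : a.val + 1 ≠ b.val) : ∃ j, a < j ∧ j < b ∧ {a, j, b} ∈ τ := by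
  have hmid : AffineMap.lineMap (P.vertex a) (P.vertex b) (1 / 2 : ℝ) ∈ ⋃ S ∈ τ, P.region S := by
    rw [h.covers hab']
    exact (P.convex_region _).lineMap_mem (P.vertex_mem_region (Set.left_mem_Icc.2 hab.le))
      (P.vertex_mem_region (Set.right_mem_Icc.2 hab.le)) ⟨by norm_num, by norm_num⟩
  obtain ⟨S, hS, hx⟩ := Set.mem_iUnion₂.1 hmid
  have ha : a ∈ S := by
    by_contra ha
    have ha' : a.val + 1 < n + 2 := by omega
    have hle : ∀ k ∈ S, (⟨a.val + 1, ha'⟩ : Fin (n + 2)) ≤ k ∧ k ≤ b := by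
      intro k hk
      have := h.mem_Icc hS hk
      have : k ≠ a := fun e => ha (e ▸ hk)
      simp only [Fin.le_def]
      omega
    have h1 := P.signedArea_nonpos_of_mem_region hle hx
    rw [signedArea_lineMap, signedArea_right] at h1
    have h2 := P.signedArea_chord_pos (i := ⟨a.val + 1, ha'⟩) (j := b) (k := a)
      (by simp only [Fin.lt_def]; omega) (.inl (by simp [Fin.lt_def]))
    linarith
  have hb : b ∈ S := by
    by_contra hb
    have hb' : b.val - 1 < n + 2 := by omega
    have hle : ∀ k ∈ S, a ≤ k ∧ k ≤ (⟨b.val - 1, hb'⟩ : Fin (n + 2)) := by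
      intro k hk
      have := h.mem_Icc hS hk
      have : k ≠ b := fun e => hb (e ▸ hk)
      simp only [Fin.le_def]
      omega
    have h1 := P.signedArea_nonpos_of_mem_region hle hx
    rw [signedArea_lineMap, signedArea_left] at h1
    have h2 := P.signedArea_chord_pos (i := a) (j := ⟨b.val - 1, hb'⟩) (k := b)
      (by simp only [Fin.lt_def]; omega) (.inr (by simp only [Fin.lt_def]; omega))
    linarith
  have hcard := h.triangle S hS
  obtain ⟨j, hj, hj'⟩ := Finset.exists_mem_notMem_of_card_lt_card
    (s := {a, b}) (t := S) (by rw [hcard]; exact Finset.card_le_two.trans_lt (by norm_num))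
  simp only [Finset.mem_insert, Finset.mem_singleton, not_or] at hj'
  have hjab := h.mem_Icc hS hj
  refine ⟨j, by omega, by omega, ?_⟩
  have : {a, j, b} = S := by
    refine Finset.eq_of_subset_of_card_le ?_ ?_
    · intro k hk
      simp only [Finset.mem_insert, Finset.mem_singleton] at hk
      rcases hk with rfl | rfl | rfl <;> assumption
    · rw [hcard, Finset.card_eq_three.2 ⟨a, j, b, Ne.symm hj'.1, hab.ne, hj'.2, rfl⟩]
  rwa [this]

/-- Vertices of `S` on both sides of `j` span an edge that crosses `a j` or `j b`, unless they are
`a` and `b` themselves. In that case the third vertex can only be `j`. -/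
theorem subset_or_subset (h : P.IsTriangulationBetween a b τ) (haj : a < j) (hjb : j < b)
    (hT : {a, j, b} ∈ τ) {S : Finset (Fin (n + 2))} (hS : S ∈ τ) (hST : S ≠ {a, j, b}) :
    S ⊆ Finset.Icc a j ∨ S ⊆ Finset.Icc j b := by
  by_contra! hcon
  obtain ⟨⟨c, hc, hcj⟩, ⟨d, hd, hdj⟩⟩ : (∃ c ∈ S, j < c) ∧ ∃ d ∈ S, d < j := by
    refine ⟨?_, ?_⟩
    · obtain ⟨c, hc, hc'⟩ := Finset.not_subset.1 hcon.1
      have := h.mem_Icc hS hc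
      rw [Finset.mem_Icc] at hc'
      exact ⟨c, hc, by omega⟩
    · obtain ⟨c, hc, hc'⟩ := Finset.not_subset.1 hcon.2
      have := h.mem_Icc hS hc
      rw [Finset.mem_Icc] at hc'
      exact ⟨c, hc, by omega⟩
  have hc3 := h.triangle S hS
  have hT3 := h.triangle _ hT
  have hdis := h.nonoverlapping S hS _ hT hST
  have key : ∀ x ∈ S, ∀ y ∈ S, x < j → j < y → x = a ∧ y = b := by
    intro x hx y hy hxj hjy
    have hxa := h.mem_Icc hS hx
    have hyb := h.mem_Icc hS hy
    by_contra hne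
    rcases lt_or_ge a x with hax | hax
    · exact P.not_disjoint_interior_region hT3 hc3 hax hxj hjy (by simp) (by simp) hx hy hdis.symm
    · have hyb' : y < b := by omega
      exact P.not_disjoint_interior_region hc3 hT3 hxj hjy hyb' hx hy (by simp) (by simp) hdis
  obtain ⟨rfl, rfl⟩ := key d hd c hc hdj hcj
  obtain ⟨x, hx, hx'⟩ := Finset.exists_mem_notMem_of_card_lt_card
    (s := {d, c}) (t := S) (by rw [hc3]; exact Finset.card_le_two.trans_lt (by norm_num))
  simp only [Finset.mem_insert, Finset.mem_singleton, not_or] at hx'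
  rcases lt_trichotomy x j with hxj | rfl | hxj
  · exact hx'.1 (key x hx c hc hxj hcj).1
  · refine hST (Finset.eq_of_subset_of_card_le ?_ ?_).symm
    · intro k hk
      simp only [Finset.mem_insert, Finset.mem_singleton] at hk
      rcases hk with rfl | rfl | rfl <;> assumption
    · rw [hc3, hT3]
  · exact hx'.2 (key d hd x hx hdj hxj).2

/-- The triangle `a j b` and everything in `Icc j b` lie beyond the chord `a j`, so no triangle
crosses it and `iUnion_region_filter_eq` applies. -/
theorem left (h : P.IsTriangulationBetween a b τ) (haj : a < j) (hjb : j < b)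
    (hT : {a, j, b} ∈ τ) :
    P.IsTriangulationBetween a j (τ.filter (· ⊆ Finset.Icc a j)) where
  triangle S hS := h.triangle S (Finset.mem_filter.1 hS).1
  subset_Icc S hS := (Finset.mem_filter.1 hS).2
  nonoverlapping S hS S' hS' :=
    h.nonoverlapping S (Finset.mem_filter.1 hS).1 S' (Finset.mem_filter.1 hS').1
  covers hne := by
    refine P.iUnion_region_filter_eq (m := ⟨a.val + 1, by omega⟩) (by simp [Fin.lt_def])
      (by simp only [Fin.lt_def]; omega) ?_ fun S hS => ?_
    · rw [h.covers (by omega)]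
      exact P.region_mono (Set.Icc_subset_Icc_right hjb.le)
    · by_cases hST : S = {a, j, b}
      · subst hST
        right
        intro k hk
        simp only [Finset.mem_insert, Finset.mem_singleton] at hk
        omega
      · refine (h.subset_or_subset haj hjb hT hS hST).imp_right fun hS' k hk => ?_
        exact .inr (Finset.mem_Icc.1 (hS' hk)).1

theorem right (h : P.IsTriangulationBetween a b τ) (haj : a < j) (hjb : j < b)
    (hT : {a, j, b} ∈ τ) :
    P.IsTriangulationBetween j b (τ.filter (· ⊆ Finset.Icc j b)) where
  triangle S hS := h.triangle S (Finset.mem_filter.1 hS).1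
  subset_Icc S hS := (Finset.mem_filter.1 hS).2
  nonoverlapping S hS S' hS' :=
    h.nonoverlapping S (Finset.mem_filter.1 hS).1 S' (Finset.mem_filter.1 hS').1
  covers hne := by
    refine P.iUnion_region_filter_eq (m := ⟨j.val + 1, by omega⟩) (by simp [Fin.lt_def])
      (by simp only [Fin.lt_def]; omega) ?_ fun S hS => ?_
    · rw [h.covers (by omega)]
      exact P.region_mono (Set.Icc_subset_Icc_left haj.le)
    · by_cases hST : S = {a, j, b}
      · subst hST
        right
        intro k hk
        simp only [Finset.mem_insert, Finset.mem_singleton] at hk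
        omega
      · refine (h.subset_or_subset haj hjb hT hS hST).symm.imp_right fun hS' k hk => ?_
        exact .inl (Finset.mem_Icc.1 (hS' hk)).2

theorem glue {l r : Finset (Finset (Fin (n + 2)))} (haj : a < j) (hjb : j < b)
    (hl : P.IsTriangulationBetween a j l) (hr : P.IsTriangulationBetween j b r) :
    P.IsTriangulationBetween a b (insert {a, j, b} (l ∪ r)) := by
  have hT : ∀ k ∈ ({a, j, b} : Finset (Fin (n + 2))), k = a ∨ k = j ∨ k = b := by simp
  have hlT : ∀ S ∈ l, Disjoint (interior (P.region S))
      (interior (P.region ({a, j, b} : Finset (Fin (n + 2))))) := fun S hS =>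
    P.disjoint_interior_region haj (.inr hjb) (fun k hk => hl.mem_Icc hS hk) fun k hk => by
      have := hT k hk
      omega
  have hrT : ∀ S ∈ r, Disjoint (interior (P.region S))
      (interior (P.region ({a, j, b} : Finset (Fin (n + 2))))) := fun S hS =>
    P.disjoint_interior_region hjb (.inl haj) (fun k hk => hr.mem_Icc hS hk) fun k hk => by
      have := hT k hk
      omega
  have hlr : ∀ S ∈ l, ∀ S' ∈ r, Disjoint (interior (P.region S)) (interior (P.region S')) :=
    fun S hS S' hS' =>
    P.disjoint_interior_region haj (.inr hjb) (fun k hk => hl.mem_Icc hS hk) fun k hk =>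
      .inr (hr.mem_Icc hS' hk).1
  refine ⟨?_, ?_, ?_, ?_⟩
  · intro S hS
    rw [Finset.mem_insert, Finset.mem_union] at hS
    rcases hS with rfl | hS | hS
    · exact Finset.card_eq_three.2 ⟨a, j, b, haj.ne, (haj.trans hjb).ne, hjb.ne, rfl⟩
    · exact hl.triangle S hS
    · exact hr.triangle S hS
  · intro S hS k hk
    rw [Finset.mem_insert, Finset.mem_union] at hS
    rw [Finset.mem_Icc]
    rcases hS with rfl | hS | hS
    · have := hT k hk
      omega
    · have := hl.mem_Icc hS hk
      omega
    · have := hr.mem_Icc hS hk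
      omega
  · intro S hS S' hS' hne
    rw [Finset.mem_insert, Finset.mem_union] at hS hS'
    rcases hS with rfl | hS | hS <;> rcases hS' with rfl | hS' | hS'
    · exact absurd rfl hne
    · exact (hlT S' hS').symm
    · exact (hrT S' hS').symm
    · exact hlT S hS
    · exact hl.nonoverlapping S hS S' hS' hne
    · exact hlr S hS S' hS'
    · exact hrT S hS
    · exact (hlr S' hS' S hS).symm
    · exact hr.nonoverlapping S hS S' hS' hne
  · intro _
    have hTsub : P.region {a, j, b} ⊆ ⋃ S ∈ insert {a, j, b} (l ∪ r), P.region S := by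
      refine Set.subset_iUnion₂_of_subset {a, j, b} (by simp) ?_
      simp
    refine subset_antisymm (Set.iUnion₂_subset fun S hS => P.region_mono fun k hk => ?_) ?_
    · rw [Finset.mem_insert, Finset.mem_union] at hS
      rw [Set.mem_Icc]
      rcases hS with rfl | hS | hS
      · have := hT k hk
        omega
      · have := hl.mem_Icc hS hk
        omega
      · have := hr.mem_Icc hS hk
        omega
    · refine (P.region_Icc_subset haj hjb).trans (Set.union_subset ?_ (Set.union_subset hTsub ?_))
      -- If `j = a + 1`, the left piece is an edge without triangles, and it is already covered as a
      -- side of `{a, j, b}`.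
      · by_cases hne : a.val + 1 = j.val
        · refine (P.region_mono fun k hk => ?_).trans hTsub
          simp only [Set.mem_Icc, Fin.le_def] at hk
          simp only [Set.mem_insert_iff, Set.mem_singleton_iff, Fin.ext_iff]
          omega
        · rw [← hl.covers hne]
          exact Set.iUnion₂_subset fun S hS =>
            Set.subset_iUnion₂_of_subset S (by simp [hS]) subset_rfl
      · by_cases hne : j.val + 1 = b.val
        · refine (P.region_mono fun k hk => ?_).trans hTsub
          simp only [Set.mem_Icc, Fin.le_def] at hk
          simp only [Set.mem_insert_iff, Set.mem_singleton_iff, Fin.ext_iff]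
          omega
        · rw [← hr.covers hne]
          exact Set.iUnion₂_subset fun S hS =>
            Set.subset_iUnion₂_of_subset S (by simp [hS]) subset_rfl

end IsTriangulationBetween

end MarkedPolygon

/-! ### Lagrange inversion for the symmetric system -/

/-- The coefficient of `y ^ p * z ^ q` in `u ^ k`, where `u = y (1 + v) ^ 2` and
`v = z (1 + u) ^ 2`. -/
noncomputable def lagrangeCoeff (k p q : ℕ) : ℚ :=
  if k = 0 then (if p = 0 ∧ q = 0 then 1 else 0)
  else if k ≤ p then (k : ℚ) / p * (2 * p).choose q * (2 * q).choose (p - k) else 0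

/-- Absorbing `j` by `j * (m + 1).choose j = (m + 1) * m.choose (j - 1)` leaves Vandermonde's
convolution. -/
theorem sum_mul_choose_mul_choose (m n q : ℕ) :
    ∑ j ∈ Finset.range (q + 2), (j : ℚ) * (m + 1).choose j * n.choose (q + 1 - j) =
      (m + 1) * (m + n).choose q := by
  rw [Finset.sum_range_succ']
  simp only [Nat.cast_zero, zero_mul, add_zero]
  rw [Nat.add_choose_eq, Finset.Nat.sum_antidiagonal_eq_sum_range_succ
    (fun i j => m.choose i * n.choose j), Nat.cast_sum, Finset.mul_sum]
  refine Finset.sum_congr rfl fun j _ => ?_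
  have h := Nat.add_one_mul_choose_eq m j
  have h' : ((m : ℚ) + 1) * m.choose j = (m + 1).choose (j + 1) * (j + 1) := by exact_mod_cast h
  rw [show q + 1 - (j + 1) = q - j by omega]
  push_cast
  linear_combination (-(n.choose (q - j) : ℚ)) * h'

theorem lagrangeCoeff_zero_right (k p : ℕ) : lagrangeCoeff k p 0 = if p = k then 1 else 0 := by
  unfold lagrangeCoeff
  rcases Nat.eq_zero_or_pos k with rfl | hk
  · simp
  · rw [if_neg hk.ne']
    split_ifs with h1 h2 h2
    · subst h2
      have : (p : ℚ) ≠ 0 := by positivity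
      simp [this]
    · have : p - k ≠ 0 := by omega
      simp [Nat.choose_eq_zero_of_lt (Nat.pos_of_ne_zero this)]
    · omega
    · rfl

/-- The relation `u ^ k = y ^ k * ∑ j, (2 * k).choose j * v ^ j` between coefficients. -/
theorem lagrangeCoeff_eq_sum {k p : ℕ} (hk : k ≠ 0) (hkp : k ≤ p) (q : ℕ) :
    lagrangeCoeff k p q =
      ∑ j ∈ Finset.range (2 * k + 1), ((2 * k).choose j : ℚ) * lagrangeCoeff j q (p - k) := by
  rcases q with _ | q
  · rw [lagrangeCoeff_zero_right, Finset.sum_range_succ']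
    rw [Finset.sum_eq_zero]
    · simp only [lagrangeCoeff, Nat.choose_zero_right, if_true, true_and, zero_add, Nat.cast_one,
        one_mul]
      congr 1
      simp; omega
    · intro j _
      simp [lagrangeCoeff]
  have hp : (p : ℚ) ≠ 0 := by
    have : p ≠ 0 := by omega
    exact_mod_cast this
  -- The last factor does not depend on `j`, so the sum is that of `sum_mul_choose_mul_choose`. The
  -- factor `j` accounts for `lagrangeCoeff 0 (q + 1) _ = 0`, and the `if` guards the truncated
  -- subtraction.
  have h1 : ∀ j, ((2 * k).choose j : ℚ) * lagrangeCoeff j (q + 1) (p - k) =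
      ((j : ℚ) * (2 * k).choose j * (if j ≤ q + 1 then (2 * (p - k)).choose (q + 1 - j) else 0 : ℕ)) *
        ((2 * (q + 1)).choose (p - k) / (q + 1 : ℚ)) := by
    intro j
    rcases Nat.eq_zero_or_pos j with rfl | hj
    · simp [lagrangeCoeff]
    · rw [lagrangeCoeff, if_neg hj.ne']
      split_ifs
      · push_cast; ring
      · simp
  rw [Finset.sum_congr rfl fun j _ => h1 j, ← Finset.sum_mul]
  have h2 : ∑ j ∈ Finset.range (2 * k + 1), ((j : ℚ) * (2 * k).choose j *
      (if j ≤ q + 1 then (2 * (p - k)).choose (q + 1 - j) else 0 : ℕ)) =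
      ∑ j ∈ Finset.range (q + 2), (j : ℚ) * (2 * k).choose j *
        (2 * (p - k)).choose (q + 1 - j) := by
    set N := 2 * k + 1 + (q + 2)
    trans ∑ j ∈ Finset.range N, ((j : ℚ) * (2 * k).choose j *
      (if j ≤ q + 1 then (2 * (p - k)).choose (q + 1 - j) else 0 : ℕ))
    · refine Finset.sum_subset (by simp [N]) fun j _ hj => ?_
      simp only [Finset.mem_range, not_lt] at hj
      simp [Nat.choose_eq_zero_of_lt (show 2 * k < j by omega)]
    · symm
      trans ∑ j ∈ Finset.range (q + 2), ((j : ℚ) * (2 * k).choose j *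
        (if j ≤ q + 1 then (2 * (p - k)).choose (q + 1 - j) else 0 : ℕ))
      · refine Finset.sum_congr rfl fun j hj => ?_
        simp only [Finset.mem_range] at hj
        rw [if_pos (by omega)]
      refine Finset.sum_subset (by simp [N]) fun j _ hj => ?_
      simp only [Finset.mem_range, not_lt] at hj
      rw [if_neg (by omega)]
      simp
  rw [h2]
  obtain ⟨m, hm⟩ : ∃ m, 2 * k = m + 1 := ⟨2 * k - 1, by omega⟩
  rw [hm, sum_mul_choose_mul_choose]
  have h3 : ((2 * p : ℕ) : ℚ) * (m + 2 * (p - k)).choose q =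
      (2 * p).choose (q + 1) * (q + 1) := by
    have := Nat.add_one_mul_choose_eq (m + 2 * (p - k)) q
    rw [show m + 2 * (p - k) + 1 = 2 * p by omega] at this
    exact_mod_cast this
  have hm' : (m : ℚ) + 1 = 2 * k := by exact_mod_cast hm.symm
  rw [lagrangeCoeff, if_neg hk, if_pos hkp, hm']
  have hq : (q : ℚ) + 1 ≠ 0 := by positivity
  push_cast at h3
  have h4 : ((m + 2 * (p - k)).choose q : ℚ) = (2 * p).choose (q + 1) * (q + 1) / (2 * p) := by
    field_simp
    linarith
  rw [h4]
  field_simp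

/-- `F ^ k = X ^ k * c ^ k * (1 + G) ^ (2 * k)`. For `k > 0` this involves `G` only in degrees below
`n`, which makes the induction possible. -/
theorem coeff_pow_of_eq_mul_one_add_sq {R : Type*} [CommRing R] {F G : PowerSeries R} {c : R}
    (hF : F = PowerSeries.X * PowerSeries.C c * (1 + G) ^ 2) (n k : ℕ) :
    PowerSeries.coeff n (F ^ k) = if k ≤ n then
      c ^ k * ∑ j ∈ Finset.range (2 * k + 1),
        ((2 * k).choose j : R) * PowerSeries.coeff (n - k) (G ^ j) else 0 := by
  have hpow : F ^ k = PowerSeries.X ^ k * (PowerSeries.C (c ^ k) *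
      (∑ j ∈ Finset.range (2 * k + 1), PowerSeries.C ((2 * k).choose j : R) * G ^ j)) := by
    have hsum : (1 + G) ^ (2 * k) =
        ∑ j ∈ Finset.range (2 * k + 1), PowerSeries.C ((2 * k).choose j : R) * G ^ j := by
      rw [add_comm, add_pow]
      refine Finset.sum_congr rfl fun j _ => ?_
      rw [one_pow, mul_one, mul_comm, map_natCast]
    rw [hF, mul_pow, mul_pow, ← pow_mul, ← map_pow, mul_assoc, hsum]
  rw [hpow, PowerSeries.coeff_X_pow_mul']
  split_ifs with hkn
  · rw [PowerSeries.coeff_C_mul, map_sum]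
    simp only [PowerSeries.coeff_C_mul]
  · rfl

/-- The coefficients of the powers of the solution `F` of the functional equation
`F = x t (1 + F̄) ^ 2`, where `F̄` is obtained from `F` by `t ↦ t⁻¹`. -/
theorem coeff_pow_of_functional_equation {F : PowerSeries ℚ[T;T⁻¹]}
    (hF : F = PowerSeries.X * PowerSeries.C (LaurentPolynomial.T 1) *
      (1 + PowerSeries.map (LaurentPolynomial.invert (R := ℚ) : ℚ[T;T⁻¹] →+* ℚ[T;T⁻¹]) F) ^ 2)
    (n k : ℕ) :
    PowerSeries.coeff n (F ^ k) = ∑ x ∈ Finset.HasAntidiagonal.antidiagonal n,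
      LaurentPolynomial.C (lagrangeCoeff k x.1 x.2) * LaurentPolynomial.T ((x.1 : ℤ) - x.2) := by
  induction n using Nat.strong_induction_on generalizing k with
  | _ n ih =>
  rcases Nat.eq_zero_or_pos k with rfl | hk
  · rw [pow_zero, PowerSeries.coeff_one]
    split_ifs with hn
    · subst hn
      simp [lagrangeCoeff]
    · symm
      refine Finset.sum_eq_zero fun x hx => ?_
      rw [Finset.HasAntidiagonal.mem_antidiagonal] at hx
      have : ¬ (x.1 = 0 ∧ x.2 = 0) := by omega
      simp [lagrangeCoeff, this]
  set ι := (LaurentPolynomial.invert (R := ℚ) : ℚ[T;T⁻¹] →+* ℚ[T;T⁻¹]) with hι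
  rw [coeff_pow_of_eq_mul_one_add_sq hF, LaurentPolynomial.T_pow, mul_one]
  split_ifs with hkn
  -- Inverting `t` exchanges the two exponents, so powers of `F̄` have the coefficients
  -- `lagrangeCoeff j q p`.
  · have h1 : ∀ j, ((2 * k).choose j : ℚ[T;T⁻¹]) *
        PowerSeries.coeff (n - k) ((PowerSeries.map ι F) ^ j) =
        ∑ x ∈ Finset.HasAntidiagonal.antidiagonal (n - k), LaurentPolynomial.C
          (((2 * k).choose j : ℚ) * lagrangeCoeff j x.2 x.1) *
            LaurentPolynomial.T ((x.1 : ℤ) - x.2) := by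
      intro j
      rw [← map_pow, PowerSeries.coeff_map, ih (n - k) (by omega) j, map_sum,
        Finset.mul_sum]
      refine Finset.sum_nbij' Prod.swap Prod.swap ?_ ?_ ?_ ?_ ?_
      · intro x
        simp [add_comm]
      · intro x
        simp [add_comm]
      · simp
      · simp
      · intro x _
        simp only [Prod.fst_swap, Prod.snd_swap, hι, RingHom.coe_coe,
          map_mul, LaurentPolynomial.invert_C, LaurentPolynomial.invert_T, neg_sub, mul_assoc,
          map_natCast]
    rw [Finset.sum_congr rfl fun j _ => h1 j, Finset.sum_comm, Finset.mul_sum]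
    symm
    -- Pairs with `p < k` contribute nothing. The others are pairs of total degree `n - k` with `p`
    -- shifted by `k`.
    rw [← Finset.sum_filter_add_sum_filter_not (Finset.HasAntidiagonal.antidiagonal n) (fun x => k ≤ x.1)]
    rw [Finset.sum_eq_zero (s := (Finset.HasAntidiagonal.antidiagonal n).filter (fun x => ¬ k ≤ x.1)), add_zero]
    · refine Finset.sum_nbij' (fun x => (x.1 - k, x.2)) (fun x => (x.1 + k, x.2)) ?_ ?_ ?_ ?_ ?_
      · intro x hx
        simp only [Finset.mem_filter, Finset.HasAntidiagonal.mem_antidiagonal] at hx ⊢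
        omega
      · intro x hx
        simp only [Finset.mem_filter, Finset.HasAntidiagonal.mem_antidiagonal] at hx ⊢
        omega
      · intro x hx
        simp only [Finset.mem_filter, Finset.HasAntidiagonal.mem_antidiagonal] at hx ⊢
        ext <;> simp; omega
      · intro x hx
        simp
      · intro x hx
        simp only [Finset.mem_filter, Finset.HasAntidiagonal.mem_antidiagonal] at hx
        rw [lagrangeCoeff_eq_sum hk.ne' hx.2, map_sum, ← Finset.sum_mul, mul_comm, mul_left_comm,
          mul_comm]
        rw [← LaurentPolynomial.T_add, Nat.cast_sub hx.2]
        congr 2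
        ring
    · intro x hx
      simp only [Finset.mem_filter, Finset.HasAntidiagonal.mem_antidiagonal] at hx
      simp [lagrangeCoeff, hk.ne', hx.2]
  · symm
    refine Finset.sum_eq_zero fun x hx => ?_
    rw [Finset.HasAntidiagonal.mem_antidiagonal] at hx
    have : ¬ k ≤ x.1 := by omega
    simp [lagrangeCoeff, hk.ne', this]

/-! ### The recursive sequence and its closed forms -/

/-- The sequence defined by the recursion that cuts off the triangle at the marked edge. -/
noncomputable def checkerboardSeq : ℕ → ℚ[T;T⁻¹]
  | 0 => 1
  | n + 1 => LaurentPolynomial.T 1 * ∑ i : Fin (n + 1),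
      LaurentPolynomial.invert (checkerboardSeq i) *
        LaurentPolynomial.invert (checkerboardSeq (n - i))

theorem checkerboardSeq_succ (n : ℕ) : checkerboardSeq (n + 1) =
    LaurentPolynomial.T 1 * ∑ i ∈ Finset.range (n + 1),
      LaurentPolynomial.invert (checkerboardSeq i) *
        LaurentPolynomial.invert (checkerboardSeq (n - i)) := by
  rw [checkerboardSeq, Finset.sum_range]

theorem checkerboardSeq_functional_equation :
    PowerSeries.mk checkerboardSeq - 1 = PowerSeries.X *
      PowerSeries.C (LaurentPolynomial.T 1) *
      (1 + PowerSeries.map (LaurentPolynomial.invert (R := ℚ) : ℚ[T;T⁻¹] →+* ℚ[T;T⁻¹])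
        (PowerSeries.mk checkerboardSeq - 1)) ^ 2 := by
  rw [map_sub, map_one, add_sub_cancel, mul_assoc]
  ext1 n
  rcases n with _ | n
  · simp [checkerboardSeq]
  · rw [PowerSeries.coeff_succ_X_mul, PowerSeries.coeff_C_mul, sq, PowerSeries.coeff_mul, map_sub,
      PowerSeries.coeff_mk, PowerSeries.coeff_one, if_neg (Nat.succ_ne_zero n), sub_zero,
      checkerboardSeq_succ, Finset.Nat.sum_antidiagonal_eq_sum_range_succ
        (fun i j => PowerSeries.coeff i (PowerSeries.map _ (PowerSeries.mk checkerboardSeq)) *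
          PowerSeries.coeff j (PowerSeries.map _ (PowerSeries.mk checkerboardSeq)))]
    simp

/-- The number of checkerboard triangulations with `p` black and `q` white triangles. -/
noncomputable def checkerboardCount (p q : ℕ) : ℚ :=
  (2 * p).choose q * (2 * q + 1).choose p / (2 * q + 1)

theorem checkerboardSeq_eq_sum (n : ℕ) : checkerboardSeq n =
    ∑ x ∈ Finset.HasAntidiagonal.antidiagonal n,
      LaurentPolynomial.C (checkerboardCount x.1 x.2) * LaurentPolynomial.T ((x.1 : ℤ) - x.2) := by
  rcases n with _ | n
  · simp [checkerboardSeq, checkerboardCount]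
  have h := coeff_pow_of_functional_equation checkerboardSeq_functional_equation (n + 1) 1
  rw [pow_one, map_sub, PowerSeries.coeff_mk, PowerSeries.coeff_one,
    if_neg (Nat.succ_ne_zero n), sub_zero] at h
  rw [h]
  refine Finset.sum_congr rfl fun x hx => ?_
  rw [Finset.HasAntidiagonal.mem_antidiagonal] at hx
  congr 2
  obtain ⟨p, q⟩ := x
  simp only at hx ⊢
  rw [lagrangeCoeff, if_neg one_ne_zero, checkerboardCount]
  -- The form with denominator `2 * q + 1` equals `lagrangeCoeff 1 p q` by absorption, and it also
  -- makes sense at `p = 0`.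
  rcases p with _ | p
  · have : 0 < q := by omega
    simp [Nat.choose_eq_zero_of_lt this]
  · rw [if_pos (by omega)]
    have h1 : ((2 * q : ℚ) + 1) * (2 * q).choose p = (2 * q + 1).choose (p + 1) * (p + 1) := by
      exact_mod_cast Nat.add_one_mul_choose_eq (2 * q) p
    have h2 : ((2 * q + 1).choose (p + 1) : ℚ) =
        (2 * q + 1) * (2 * q).choose p / (p + 1) := by
      field_simp
      linarith
    rw [h2]
    simp only [Nat.add_sub_cancel, Nat.cast_one, Nat.cast_add]
    field_simp

theorem checkerboardCount_eq_zero {p q : ℕ} (h : 2 * p < q ∨ 2 * q + 1 < p) :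
    checkerboardCount p q = 0 := by
  unfold checkerboardCount
  rcases h with h | h <;> simp [Nat.choose_eq_zero_of_lt h]

theorem choose_succ_div (m k : ℕ) :
    ((m + 1).choose (k + 1) : ℚ) / (m + 1) = m.choose k / (k + 1) := by
  have h : ((m : ℚ) + 1) * m.choose k = (m + 1).choose (k + 1) * (k + 1) := by
    exact_mod_cast Nat.add_one_mul_choose_eq m k
  have : (m : ℚ) + 1 ≠ 0 := by positivity
  field_simp
  linarith

/-- A common reindexing for the three residues: the pairs with nonzero count are among those with
`q` in a run of `n + 1` consecutive values, numbered by `k`. -/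
theorem checkerboardSeq_eq_sum_range {N n : ℕ} {p q : ℕ → ℕ} {c : ℕ → ℚ} {e : ℕ → ℤ}
    (hpq : ∀ k ≤ n, p k + q k = N) (hq : ∀ k, q k = q 0 + k)
    (hN : ∀ x y, x + y = N → y ≤ 2 * x → x ≤ 2 * y + 1 → q 0 ≤ y ∧ y ≤ q 0 + n)
    (hc : ∀ k ≤ n, c k = checkerboardCount (p k) (q k))
    (he : ∀ k ≤ n, e k = (p k : ℤ) - q k) :
    checkerboardSeq N =
      ∑ k ∈ Finset.range (n + 1), LaurentPolynomial.C (c k) * LaurentPolynomial.T (e k) := by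
  rw [checkerboardSeq_eq_sum]
  symm
  refine Finset.sum_of_injOn (fun k => (p k, q k)) ?_ ?_ ?_ ?_
  · intro k _ k' _ h
    have := congrArg Prod.snd h
    simp only at this
    rw [hq k, hq k'] at this
    omega
  · intro k hk
    have : k ≤ n := by simpa [Nat.lt_succ_iff] using hk
    simpa using hpq k this
  · rintro ⟨x, y⟩ hxy hnot
    rw [Finset.HasAntidiagonal.mem_antidiagonal] at hxy
    simp only at hxy ⊢
    rw [checkerboardCount_eq_zero, map_zero, zero_mul]
    by_contra! hcon
    obtain ⟨h1, h2⟩ := hN x y hxy hcon.1 hcon.2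
    refine hnot ⟨y - q 0, by simp; omega, ?_⟩
    have e1 := hq (y - q 0)
    have e2 := hpq (y - q 0) (by omega)
    simp only [Prod.mk.injEq]
    omega
  · intro k hk
    have : k ≤ n := by simpa [Nat.lt_succ_iff] using hk
    rw [hc k this, he k this]

theorem checkerboardSeq_three_mul (n : ℕ) : checkerboardSeq (3 * n) =
    ∑ k ∈ Finset.range (n + 1),
      LaurentPolynomial.C
        (((4 * n - 2 * k).choose (n + k) : ℚ) * ((2 * n + 2 * k).choose (3 * k) : ℚ) /
          (3 * (k : ℚ) + 1)) *
        LaurentPolynomial.T ((n : ℤ) - 2 * (k : ℤ)) := by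
  refine checkerboardSeq_eq_sum_range (p := fun k => 2 * n - k) (q := fun k => n + k)
    (by intros; omega) (by intros; omega) (by intros; omega) (fun k hk => ?_)
    (by intros; omega)
  -- Here `2 * q + 1 - p = 3 * k + 1`; after this reflection, absorption trades the denominator `2 *
  -- q + 1` for `3 * k + 1`.
  rw [checkerboardCount, show 2 * (2 * n - k) = 4 * n - 2 * k by omega,
    show (2 * (n + k) + 1).choose (2 * n - k) = (2 * n + 2 * k + 1).choose (3 * k + 1) by
      rw [show 2 * (n + k) + 1 = 2 * n + 2 * k + 1 by ring]
      exact Nat.choose_symm_of_eq_add (by omega), mul_div_assoc, mul_div_assoc]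
  have := choose_succ_div (2 * n + 2 * k) (3 * k)
  push_cast at this ⊢
  rw [← this]
  ring_nf

theorem checkerboardSeq_three_mul_add_one (n : ℕ) : checkerboardSeq (3 * n + 1) =
    ∑ k ∈ Finset.range (n + 1),
      LaurentPolynomial.C
        (((4 * n + 2 - 2 * k).choose (n + k) : ℚ) * ((2 * n + 2 * k).choose (3 * k) : ℚ) /
          (2 * (n : ℚ) + 1 - (k : ℚ))) *
        LaurentPolynomial.T ((n : ℤ) + 1 - 2 * (k : ℤ)) := by
  refine checkerboardSeq_eq_sum_range (p := fun k => 2 * n + 1 - k) (q := fun k => n + k)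
    (by intros; omega) (by intros; omega) (by intros; omega) (fun k hk => ?_)
    (by intros; omega)
  -- Here the reflection is applied to the target instead, so that absorption produces the
  -- denominator `p = 2 * n + 1 - k`.
  rw [checkerboardCount, show 2 * (2 * n + 1 - k) = 4 * n + 2 - 2 * k by omega,
    show 2 * n + 1 - k = 2 * n - k + 1 by omega,
    show (2 * n + 2 * k).choose (3 * k) = (2 * n + 2 * k).choose (2 * n - k) from
      Nat.choose_symm_of_eq_add (by omega), mul_div_assoc, mul_div_assoc]
  have := choose_succ_div (2 * n + 2 * k) (2 * n - k)
  rw [Nat.cast_sub (by omega)] at this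
  push_cast at this ⊢
  rw [show (2 : ℚ) * n + 1 - k = 2 * n - k + 1 by ring, ← this]
  ring_nf

theorem checkerboardSeq_three_mul_add_two (n : ℕ) : checkerboardSeq (3 * n + 2) =
    ∑ k ∈ Finset.range (n + 1),
      LaurentPolynomial.C
        (((4 * n + 2 - 2 * k).choose (n + 1 + k) : ℚ) *
            ((2 * n + 2 + 2 * k).choose (3 * k + 1) : ℚ) /
          (3 * (k : ℚ) + 2)) *
        LaurentPolynomial.T ((n : ℤ) - 2 * (k : ℤ)) := by
  refine checkerboardSeq_eq_sum_range (p := fun k => 2 * n + 1 - k) (q := fun k => n + 1 + k)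
    (by intros; omega) (by intros; omega) (by intros; omega) (fun k hk => ?_)
    (by intros; omega)
  rw [checkerboardCount, show 2 * (2 * n + 1 - k) = 4 * n + 2 - 2 * k by omega,
    show (2 * (n + 1 + k) + 1).choose (2 * n + 1 - k) =
        (2 * n + 2 + 2 * k + 1).choose (3 * k + 1 + 1) by
      rw [show 2 * (n + 1 + k) + 1 = 2 * n + 2 + 2 * k + 1 by ring]
      exact Nat.choose_symm_of_eq_add (by omega), mul_div_assoc, mul_div_assoc]
  have := choose_succ_div (2 * n + 2 + 2 * k) (3 * k + 1)
  push_cast at this ⊢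
  rw [show (3 : ℚ) * k + 2 = 3 * k + 1 + 1 by ring, ← this]
  ring_nf

/-! ### Cutting and gluing checkerboard triangulations -/

namespace MarkedPolygon

variable {n : ℕ} (P : MarkedPolygon n)

theorem EdgeAdjacent.symm {S S' : Finset (Fin (n + 2))} (h : EdgeAdjacent S S') :
    EdgeAdjacent S' S :=
  ⟨h.1.symm, by rw [Finset.inter_comm]; exact h.2⟩

/-- A checkerboard triangulation of the convex polygon spanned by the vertices from `a` to `b`,
with marked edge `a b`. -/
structure IsCheckerboardBetween (a b : Fin (n + 2))
    (black white : Finset (Finset (Fin (n + 2)))) : Prop where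
  triangulation : P.IsTriangulationBetween a b (black ∪ white)
  disjoint : Disjoint black white
  black_not_adjacent : ∀ S ∈ black, ∀ S' ∈ black, ¬ EdgeAdjacent S S'
  white_not_adjacent : ∀ S ∈ white, ∀ S' ∈ white, ¬ EdgeAdjacent S S'
  marked_black : ∀ S ∈ black ∪ white, a ∈ S → b ∈ S → S ∈ black

theorem isCheckerboard_iff (black white : Finset (Finset (Fin (n + 2)))) :
    P.IsCheckerboard black white ↔
      P.IsCheckerboardBetween 0 (Fin.last (n + 1)) black white := by
  have hI : Set.Icc 0 (Fin.last (n + 1)) = Set.univ := by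
    ext k
    simp [Fin.le_last]
  have hn : ((0 : Fin (n + 2)).val + 1 ≠ (Fin.last (n + 1)).val) ↔ n ≠ 0 := by
    simp only [Fin.val_zero, Fin.val_last]
    omega
  constructor
  · intro h
    refine ⟨⟨h.triangulation.triangle, fun S _ k _ => by simp [Fin.le_last],
      h.triangulation.nonoverlapping, fun h0 => ?_⟩, h.disjoint, h.black_not_adjacent,
      h.white_not_adjacent, h.marked_black⟩
    rw [hI]
    exact h.triangulation.covers (hn.1 h0)
  · intro h
    refine ⟨⟨h.triangulation.triangle, h.triangulation.nonoverlapping, fun h0 => ?_⟩, h.disjoint,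
      h.black_not_adjacent, h.white_not_adjacent, h.marked_black⟩
    rw [h.triangulation.covers (hn.2 h0), hI]

namespace IsCheckerboardBetween

variable {P} {a b j : Fin (n + 2)} {black white : Finset (Finset (Fin (n + 2)))}

theorem eq_empty (h : P.IsCheckerboardBetween a b black white) (hab : a.val + 1 = b.val) :
    black = ∅ ∧ white = ∅ := by
  rw [← Finset.union_eq_empty, Finset.eq_empty_iff_forall_notMem]
  intro S hS
  have h1 := Finset.card_le_card (h.triangulation.subset_Icc S hS)
  rw [h.triangulation.triangle S hS, Fin.card_Icc] at h1
  omega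

theorem empty (hab : a.val + 1 = b.val) : P.IsCheckerboardBetween a b ∅ ∅ :=
  ⟨⟨by simp, by simp, by simp, fun h => absurd hab h⟩, by simp, by simp, by simp, by simp⟩

/-- The colours are exchanged: a black triangle containing the side `a j` would be adjacent to the
black triangle `a j b`, so the one on that side is white. -/
theorem left (h : P.IsCheckerboardBetween a b black white) (haj : a < j) (hjb : j < b)
    (hT : {a, j, b} ∈ black) : P.IsCheckerboardBetween a j
      (white.filter (· ⊆ Finset.Icc a j)) (black.filter (· ⊆ Finset.Icc a j)) where
  triangulation := by
    rw [← Finset.filter_union, Finset.union_comm]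
    exact h.triangulation.left haj hjb (Finset.mem_union_left _ hT)
  disjoint := Finset.disjoint_filter_filter h.disjoint.symm
  black_not_adjacent S hS S' hS' :=
    h.white_not_adjacent S (Finset.mem_filter.1 hS).1 S' (Finset.mem_filter.1 hS').1
  white_not_adjacent S hS S' hS' :=
    h.black_not_adjacent S (Finset.mem_filter.1 hS).1 S' (Finset.mem_filter.1 hS').1
  marked_black S hS ha hj := by
    rcases Finset.mem_union.1 hS with hS | hS
    · exact hS
    exfalso
    obtain ⟨hSb, hSI⟩ := Finset.mem_filter.1 hS
    have hb : b ∉ S := fun hb => by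
      have := Finset.mem_Icc.1 (hSI hb)
      omega
    refine h.black_not_adjacent S hSb _ hT ⟨fun e => hb (e ▸ by simp), ?_⟩
    have : S ∩ {a, j, b} = {a, j} := by
      ext k
      simp only [Finset.mem_inter, Finset.mem_insert, Finset.mem_singleton]
      constructor
      · rintro ⟨hk, rfl | rfl | rfl⟩
        · simp
        · simp
        · exact absurd hk hb
      · rintro (rfl | rfl) <;> simp [ha, hj]
    rw [this, Finset.card_pair haj.ne]

theorem right (h : P.IsCheckerboardBetween a b black white) (haj : a < j) (hjb : j < b)
    (hT : {a, j, b} ∈ black) : P.IsCheckerboardBetween j b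
      (white.filter (· ⊆ Finset.Icc j b)) (black.filter (· ⊆ Finset.Icc j b)) where
  triangulation := by
    rw [← Finset.filter_union, Finset.union_comm]
    exact h.triangulation.right haj hjb (Finset.mem_union_left _ hT)
  disjoint := Finset.disjoint_filter_filter h.disjoint.symm
  black_not_adjacent S hS S' hS' :=
    h.white_not_adjacent S (Finset.mem_filter.1 hS).1 S' (Finset.mem_filter.1 hS').1
  white_not_adjacent S hS S' hS' :=
    h.black_not_adjacent S (Finset.mem_filter.1 hS).1 S' (Finset.mem_filter.1 hS').1
  marked_black S hS hj hb := by
    rcases Finset.mem_union.1 hS with hS | hS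
    · exact hS
    exfalso
    obtain ⟨hSb, hSI⟩ := Finset.mem_filter.1 hS
    have ha : a ∉ S := fun ha => by
      have := Finset.mem_Icc.1 (hSI ha)
      omega
    refine h.black_not_adjacent S hSb _ hT ⟨fun e => ha (e ▸ by simp), ?_⟩
    have : S ∩ {a, j, b} = {j, b} := by
      ext k
      simp only [Finset.mem_inter, Finset.mem_insert, Finset.mem_singleton]
      constructor
      · rintro ⟨hk, rfl | rfl | rfl⟩
        · exact absurd hk ha
        · simp
        · simp
      · rintro (rfl | rfl) <;> simp [hb, hj]
    rw [this, Finset.card_pair hjb.ne]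

variable {lb lw rb rv : Finset (Finset (Fin (n + 2)))}

theorem not_subset_Icc_right (hl : P.IsCheckerboardBetween a j lb lw)
    {S : Finset (Fin (n + 2))} (hS : S ∈ lb ∪ lw) : ¬ S ⊆ Finset.Icc j b := fun h => by
  have h3 := hl.triangulation.triangle S hS
  have : S ⊆ {j} := fun k hk => by
    have h1 := Finset.mem_Icc.1 (h hk)
    have h2 := hl.triangulation.mem_Icc hS hk
    rw [Finset.mem_singleton]
    omega
  have := Finset.card_le_card this
  simp [h3] at this

theorem not_subset_Icc_left (hr : P.IsCheckerboardBetween j b rb rv)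
    {S : Finset (Fin (n + 2))} (hS : S ∈ rb ∪ rv) : ¬ S ⊆ Finset.Icc a j := fun h => by
  have h3 := hr.triangulation.triangle S hS
  have : S ⊆ {j} := fun k hk => by
    have h1 := Finset.mem_Icc.1 (h hk)
    have h2 := hr.triangulation.mem_Icc hS hk
    rw [Finset.mem_singleton]
    omega
  have := Finset.card_le_card this
  simp [h3] at this

/-- Triangles from different pieces share at most the vertex `j`. -/
theorem not_edgeAdjacent (hl : P.IsCheckerboardBetween a j lb lw)
    (hr : P.IsCheckerboardBetween j b rb rv) {S S' : Finset (Fin (n + 2))} (hS : S ∈ lb ∪ lw)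
    (hS' : S' ∈ rb ∪ rv) : ¬ EdgeAdjacent S S' := fun h => by
  have : S ∩ S' ⊆ {j} := fun k hk => by
    rw [Finset.mem_inter] at hk
    have h1 := hl.triangulation.mem_Icc hS hk.1
    have h2 := hr.triangulation.mem_Icc hS' hk.2
    rw [Finset.mem_singleton]
    omega
  have := Finset.card_le_card this
  simp [h.2] at this

/-- The common edge could only be `a j`, the marked edge of the left piece, and the triangle there
is black in that piece. -/
theorem not_edgeAdjacent_left (hl : P.IsCheckerboardBetween a j lb lw)
    (hjb : j < b) {S : Finset (Fin (n + 2))} (hS : S ∈ lw) :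
    ¬ EdgeAdjacent S {a, j, b} := fun h => by
  have hS' := Finset.mem_union_right lb hS
  have hsub : S ∩ {a, j, b} ⊆ {a, j} := fun k hk => by
    rw [Finset.mem_inter] at hk
    have h1 := hl.triangulation.mem_Icc hS' hk.1
    have h2 := hk.2
    simp only [Finset.mem_insert, Finset.mem_singleton] at h2 ⊢
    omega
  have heq := Finset.eq_of_subset_of_card_le hsub (by rw [h.2]; exact Finset.card_le_two)
  have ha : a ∈ S ∩ {a, j, b} := by rw [heq]; simp
  have hj : j ∈ S ∩ {a, j, b} := by rw [heq]; simp
  exact Finset.disjoint_left.1 hl.disjoint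
    (hl.marked_black S hS' (Finset.mem_inter.1 ha).1 (Finset.mem_inter.1 hj).1) hS

theorem not_edgeAdjacent_right (hr : P.IsCheckerboardBetween j b rb rv) (haj : a < j)
    {S : Finset (Fin (n + 2))} (hS : S ∈ rv) :
    ¬ EdgeAdjacent S {a, j, b} := fun h => by
  have hS' := Finset.mem_union_right rb hS
  have hsub : S ∩ {a, j, b} ⊆ {j, b} := fun k hk => by
    rw [Finset.mem_inter] at hk
    have h1 := hr.triangulation.mem_Icc hS' hk.1
    have h2 := hk.2
    simp only [Finset.mem_insert, Finset.mem_singleton] at h2 ⊢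
    omega
  have heq := Finset.eq_of_subset_of_card_le hsub (by rw [h.2]; exact Finset.card_le_two)
  have hj : j ∈ S ∩ {a, j, b} := by rw [heq]; simp
  have hb : b ∈ S ∩ {a, j, b} := by rw [heq]; simp
  exact Finset.disjoint_left.1 hr.disjoint
    (hr.marked_black S hS' (Finset.mem_inter.1 hj).1 (Finset.mem_inter.1 hb).1) hS

theorem notMem_left (hl : P.IsCheckerboardBetween a j lb lw) (hjb : j < b)
    {S : Finset (Fin (n + 2))} (hS : S ∈ lb ∪ lw) : b ∉ S := fun h => by
  have := hl.triangulation.mem_Icc hS h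
  omega

theorem notMem_right (hr : P.IsCheckerboardBetween j b rb rv) (haj : a < j)
    {S : Finset (Fin (n + 2))} (hS : S ∈ rb ∪ rv) : a ∉ S := fun h => by
  have := hr.triangulation.mem_Icc hS h
  omega

theorem disjoint_union (hl : P.IsCheckerboardBetween a j lb lw)
    (hr : P.IsCheckerboardBetween j b rb rv) :
    Disjoint (lb ∪ lw) (rb ∪ rv) :=
  Finset.disjoint_left.2 fun S hS hS' =>
    hl.not_subset_Icc_right hS (hr.triangulation.subset_Icc S hS')

theorem triangle_notMem (hl : P.IsCheckerboardBetween a j lb lw)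
    (hr : P.IsCheckerboardBetween j b rb rv) (haj : a < j) (hjb : j < b) :
    {a, j, b} ∉ (lb ∪ lw) ∪ (rb ∪ rv) := fun h => by
  rcases Finset.mem_union.1 h with h | h
  · exact hl.notMem_left hjb h (by simp)
  · exact hr.notMem_right haj h (by simp)

theorem glue (hl : P.IsCheckerboardBetween a j lb lw) (hr : P.IsCheckerboardBetween j b rb rv)
    (haj : a < j) (hjb : j < b) :
    P.IsCheckerboardBetween a b (insert {a, j, b} (lw ∪ rv)) (lb ∪ rb) where
  triangulation := by
    have : insert {a, j, b} (lw ∪ rv) ∪ (lb ∪ rb) = insert {a, j, b} ((lb ∪ lw) ∪ (rb ∪ rv)) := by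
      ext S
      simp only [Finset.mem_union, Finset.mem_insert]
      tauto
    rw [this]
    exact hl.triangulation.glue haj hjb hr.triangulation
  disjoint := by
    have h1 := Finset.disjoint_left.1 hl.disjoint
    have h2 := Finset.disjoint_left.1 hr.disjoint
    have h3 := Finset.disjoint_left.1 (hl.disjoint_union hr)
    have h4 := hl.triangle_notMem hr haj hjb
    rw [Finset.disjoint_right]
    intro S hS
    rw [Finset.mem_insert]
    rintro (rfl | hS')
    · simp only [Finset.mem_union] at h4 hS
      tauto
    · have := @h1 S
      have := @h2 S
      have := @h3 S
      simp only [Finset.mem_union] at *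
      tauto
  black_not_adjacent S hS S' hS' := by
    rw [Finset.mem_insert, Finset.mem_union] at hS hS'
    rcases hS with rfl | hS | hS <;> rcases hS' with rfl | hS' | hS'
    · exact fun h => h.1 rfl
    · exact fun h => hl.not_edgeAdjacent_left hjb hS' h.symm
    · exact fun h => hr.not_edgeAdjacent_right haj hS' h.symm
    · exact hl.not_edgeAdjacent_left hjb hS
    · exact hl.white_not_adjacent S hS S' hS'
    · exact hl.not_edgeAdjacent hr (Finset.mem_union_right _ hS) (Finset.mem_union_right _ hS')
    · exact hr.not_edgeAdjacent_right haj hS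
    · exact fun h => hl.not_edgeAdjacent hr (Finset.mem_union_right _ hS')
        (Finset.mem_union_right _ hS) h.symm
    · exact hr.white_not_adjacent S hS S' hS'
  white_not_adjacent S hS S' hS' := by
    rw [Finset.mem_union] at hS hS'
    rcases hS with hS | hS <;> rcases hS' with hS' | hS'
    · exact hl.black_not_adjacent S hS S' hS'
    · exact hl.not_edgeAdjacent hr (Finset.mem_union_left _ hS) (Finset.mem_union_left _ hS')
    · exact fun h => hl.not_edgeAdjacent hr (Finset.mem_union_left _ hS')
        (Finset.mem_union_left _ hS) h.symm
    · exact hr.black_not_adjacent S hS S' hS'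
  marked_black S hS ha hb := by
    rw [Finset.mem_insert]
    left
    by_contra hne
    have : S ∈ (lb ∪ lw) ∪ (rb ∪ rv) := by
      simp only [Finset.mem_union, Finset.mem_insert] at hS ⊢
      tauto
    rcases Finset.mem_union.1 this with h | h
    · exact hl.notMem_left hjb h hb
    · exact hr.notMem_right haj h ha

theorem exists_triangle (h : P.IsCheckerboardBetween a b black white) (hab : a < b)
    (hab' : a.val + 1 ≠ b.val) : ∃ j, a < j ∧ j < b ∧ {a, j, b} ∈ black := by
  obtain ⟨j, haj, hjb, hT⟩ := h.triangulation.exists_triangle_mem hab hab'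
  exact ⟨j, haj, hjb, h.marked_black _ hT (by simp) (by simp)⟩

/-- Cutting undoes gluing; this gives injectivity of the gluing map, as `eq_glue` gives
surjectivity. -/
theorem filter_glue_left (hl : P.IsCheckerboardBetween a j lb lw)
    (hr : P.IsCheckerboardBetween j b rb rv) (hjb : j < b) :
    (insert {a, j, b} (lw ∪ rv)).filter (· ⊆ Finset.Icc a j) = lw ∧
      (lb ∪ rb).filter (· ⊆ Finset.Icc a j) = lb := by
  have hT : ¬ ({a, j, b} : Finset (Fin (n + 2))) ⊆ Finset.Icc a j := fun h => by
    have := Finset.mem_Icc.1 (h (show b ∈ _ by simp))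
    omega
  have h1 : ∀ S ∈ lb ∪ lw, S ⊆ Finset.Icc a j := hl.triangulation.subset_Icc
  have h2 : ∀ S ∈ rb ∪ rv, ¬ S ⊆ Finset.Icc a j := fun S hS => hr.not_subset_Icc_left hS
  constructor
  · ext S
    have h1 := h1 S
    have h2 := h2 S
    simp only [Finset.mem_filter, Finset.mem_insert, Finset.mem_union] at *
    constructor
    · rintro ⟨rfl | h | h, h'⟩ <;> tauto
    · tauto
  · ext S
    have h1 := h1 S
    have h2 := h2 S
    simp only [Finset.mem_filter, Finset.mem_union] at *
    tauto

theorem filter_glue_right (hl : P.IsCheckerboardBetween a j lb lw)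
    (hr : P.IsCheckerboardBetween j b rb rv) (haj : a < j) :
    (insert {a, j, b} (lw ∪ rv)).filter (· ⊆ Finset.Icc j b) = rv ∧
      (lb ∪ rb).filter (· ⊆ Finset.Icc j b) = rb := by
  have hT : ¬ ({a, j, b} : Finset (Fin (n + 2))) ⊆ Finset.Icc j b := fun h => by
    have := Finset.mem_Icc.1 (h (show a ∈ _ by simp))
    omega
  have h1 : ∀ S ∈ rb ∪ rv, S ⊆ Finset.Icc j b := hr.triangulation.subset_Icc
  have h2 : ∀ S ∈ lb ∪ lw, ¬ S ⊆ Finset.Icc j b := fun S hS => hl.not_subset_Icc_right hS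
  constructor
  · ext S
    have h1 := h1 S
    have h2 := h2 S
    simp only [Finset.mem_filter, Finset.mem_insert, Finset.mem_union] at *
    constructor
    · rintro ⟨rfl | h | h, h'⟩ <;> tauto
    · tauto
  · ext S
    have h1 := h1 S
    have h2 := h2 S
    simp only [Finset.mem_filter, Finset.mem_union] at *
    tauto

theorem eq_glue (h : P.IsCheckerboardBetween a b black white) (haj : a < j) (hjb : j < b)
    (hT : {a, j, b} ∈ black) :
    insert {a, j, b} (black.filter (· ⊆ Finset.Icc a j) ∪ black.filter (· ⊆ Finset.Icc j b)) =
        black ∧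
      white.filter (· ⊆ Finset.Icc a j) ∪ white.filter (· ⊆ Finset.Icc j b) = white := by
  have key : ∀ S ∈ black ∪ white, S ≠ {a, j, b} → S ⊆ Finset.Icc a j ∨ S ⊆ Finset.Icc j b :=
    fun S hS hne => h.triangulation.subset_or_subset haj hjb (Finset.mem_union_left _ hT) hS hne
  constructor
  · ext S
    have := key S
    simp only [Finset.mem_filter, Finset.mem_insert, Finset.mem_union] at *
    constructor
    · rintro (rfl | h | h) <;> tauto
    · intro hS
      by_cases hST : S = {a, j, b} <;> tauto
  · ext S
    have := key S
    have hw : S ∈ white → S ≠ {a, j, b} := by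
      rintro hS rfl
      exact Finset.disjoint_left.1 h.disjoint hT hS
    simp only [Finset.mem_filter, Finset.mem_union] at *
    tauto

theorem triangle_unique {j' : Fin (n + 2)} (hl : P.IsCheckerboardBetween a j lb lw)
    (hr : P.IsCheckerboardBetween j b rb rv) (haj : a < j) (hjb : j < b) (haj' : a < j')
    (hjb' : j' < b) (hT : {a, j', b} ∈ insert {a, j, b} (lw ∪ rv)) : j' = j := by
  rw [Finset.mem_insert, Finset.mem_union] at hT
  rcases hT with hT | hT | hT
  · have : j' ∈ ({a, j, b} : Finset (Fin (n + 2))) := by rw [← hT]; simp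
    simp only [Finset.mem_insert, Finset.mem_singleton] at this
    omega
  · exact absurd (by simp) (hl.notMem_left hjb (Finset.mem_union_right _ hT))
  · exact absurd (by simp) (hr.notMem_right haj (Finset.mem_union_right _ hT))

end IsCheckerboardBetween

/-! ### The recursion for the winding polynomial -/

open Classical in
/-- The finite set of checkerboard triangulations of the polygon spanned by the vertices from `a`
to `b`. -/
noncomputable def checkerboardsBetween (a b : Fin (n + 2)) :
    Finset (Finset (Finset (Fin (n + 2))) × Finset (Finset (Fin (n + 2)))) :=
  Finset.univ.filter fun c => P.IsCheckerboardBetween a b c.1 c.2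

theorem mem_checkerboardsBetween {a b : Fin (n + 2)}
    {c : Finset (Finset (Fin (n + 2))) × Finset (Finset (Fin (n + 2)))} :
    c ∈ P.checkerboardsBetween a b ↔ P.IsCheckerboardBetween a b c.1 c.2 := by
  simp [checkerboardsBetween]

/-- The winding polynomial of the polygon spanned by the vertices from `a` to `b`. -/
noncomputable def weightBetween (a b : Fin (n + 2)) : ℚ[T;T⁻¹] :=
  ∑ c ∈ P.checkerboardsBetween a b, LaurentPolynomial.T ((c.1.card : ℤ) - (c.2.card : ℤ))

theorem weightBetween_of_succ_eq {a b : Fin (n + 2)} (hab : a.val + 1 = b.val) :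
    P.weightBetween a b = 1 := by
  have : P.checkerboardsBetween a b = {(∅, ∅)} := by
    ext ⟨B, W⟩
    rw [mem_checkerboardsBetween, Finset.mem_singleton, Prod.mk.injEq]
    refine ⟨fun h => h.eq_empty hab, ?_⟩
    rintro ⟨rfl, rfl⟩
    exact IsCheckerboardBetween.empty hab
  simp [weightBetween, this]

/-- Gluing is a bijection from triples of an apex `j` and checkerboards of the two pieces. The
triangle at the marked edge contributes `T 1`, and the exchange of colours in the pieces contributes
`invert`. -/
theorem weightBetween_eq_sum {a b : Fin (n + 2)} (hab : a < b) (hab' : a.val + 1 ≠ b.val) :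
    P.weightBetween a b = LaurentPolynomial.T 1 * ∑ j ∈ Finset.Ioo a b,
      LaurentPolynomial.invert (P.weightBetween a j) *
        LaurentPolynomial.invert (P.weightBetween j b) := by
  have hrhs : LaurentPolynomial.T 1 * ∑ j ∈ Finset.Ioo a b,
      LaurentPolynomial.invert (P.weightBetween a j) *
        LaurentPolynomial.invert (P.weightBetween j b) =
      ∑ x ∈ (Finset.Ioo a b).sigma
          (fun j => P.checkerboardsBetween a j ×ˢ P.checkerboardsBetween j b),
        (LaurentPolynomial.T (1 + (((x.2.1.2.card : ℤ) - x.2.1.1.card) +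
          ((x.2.2.2.card : ℤ) - x.2.2.1.card))) : ℚ[T;T⁻¹]) := by
    rw [Finset.sum_sigma, Finset.mul_sum]
    refine Finset.sum_congr rfl fun j _ => ?_
    rw [Finset.sum_product, weightBetween, weightBetween, map_sum, map_sum, Finset.sum_mul_sum,
      Finset.mul_sum]
    refine Finset.sum_congr rfl fun l _ => ?_
    rw [Finset.mul_sum]
    refine Finset.sum_congr rfl fun r _ => ?_
    simp only [LaurentPolynomial.invert_T, neg_sub, LaurentPolynomial.T_add]
  rw [hrhs, weightBetween]
  symm
  refine Finset.sum_bij (fun x _ => (insert {a, x.1, b} (x.2.1.2 ∪ x.2.2.2), x.2.1.1 ∪ x.2.2.1))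
    ?_ ?_ ?_ ?_
  · rintro ⟨j, l, r⟩ hx
    simp only [Finset.mem_sigma, Finset.mem_Ioo, Finset.mem_product,
      mem_checkerboardsBetween] at hx ⊢
    exact hx.2.1.glue hx.2.2 hx.1.1 hx.1.2
  · rintro ⟨j, ⟨lb, lw⟩, ⟨rb, rv⟩⟩ hx ⟨j', ⟨lb', lw'⟩, ⟨rb', rv'⟩⟩ hx' heq
    simp only [Finset.mem_sigma, Finset.mem_Ioo, Finset.mem_product,
      mem_checkerboardsBetween] at hx hx'
    obtain ⟨⟨haj, hjb⟩, hl, hr⟩ := hx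
    obtain ⟨⟨haj', hjb'⟩, hl', hr'⟩ := hx'
    simp only [Prod.mk.injEq] at heq
    -- The apex is recovered as the third vertex of the only black triangle on the edge `a b`.
    obtain rfl : j = j' := hl'.triangle_unique hr' haj' hjb' haj hjb (by rw [← heq.1]; simp)
    have e1 := hl.filter_glue_left hr hjb
    have e2 := hl.filter_glue_right hr haj
    have e1' := hl'.filter_glue_left hr' hjb
    have e2' := hl'.filter_glue_right hr' haj
    rw [heq.1, heq.2] at e1 e2
    obtain rfl := e1.1.symm.trans e1'.1
    obtain rfl := e1.2.symm.trans e1'.2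
    obtain rfl := e2.1.symm.trans e2'.1
    obtain rfl := e2.2.symm.trans e2'.2
    rfl
  · rintro ⟨B, W⟩ hc
    rw [mem_checkerboardsBetween] at hc
    obtain ⟨j, haj, hjb, hT⟩ := hc.exists_triangle hab hab'
    refine ⟨⟨j, (W.filter (· ⊆ Finset.Icc a j), B.filter (· ⊆ Finset.Icc a j)),
      (W.filter (· ⊆ Finset.Icc j b), B.filter (· ⊆ Finset.Icc j b))⟩, ?_, ?_⟩
    · simp only [Finset.mem_sigma, Finset.mem_Ioo, Finset.mem_product, mem_checkerboardsBetween]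
      exact ⟨⟨haj, hjb⟩, hc.left haj hjb hT, hc.right haj hjb hT⟩
    · have := hc.eq_glue haj hjb hT
      simp only [Prod.mk.injEq]
      exact this
  · rintro ⟨j, ⟨lb, lw⟩, ⟨rb, rv⟩⟩ hx
    simp only [Finset.mem_sigma, Finset.mem_Ioo, Finset.mem_product,
      mem_checkerboardsBetween] at hx ⊢
    obtain ⟨⟨haj, hjb⟩, hl, hr⟩ := hx
    have hd := hl.disjoint_union hr
    have hT := hl.triangle_notMem hr haj hjb
    rw [Finset.card_insert_of_notMem, Finset.card_union_of_disjoint, Finset.card_union_of_disjoint]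
    · congr 1
      push_cast
      ring
    · exact hd.mono Finset.subset_union_left Finset.subset_union_left
    · exact hd.mono Finset.subset_union_right Finset.subset_union_right
    · simp only [Finset.mem_union] at hT ⊢
      tauto

theorem weightBetween_eq_checkerboardSeq (a b : Fin (n + 2)) (m : ℕ) (h : a.val + m + 1 = b.val) :
    P.weightBetween a b = checkerboardSeq m := by
  induction m using Nat.strong_induction_on generalizing a b with
  | _ m ih =>
  rcases m with _ | m
  · rw [P.weightBetween_of_succ_eq (by omega), checkerboardSeq]
  · rw [P.weightBetween_eq_sum (by omega) (by omega), checkerboardSeq_succ]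
    congr 1
    refine Finset.sum_bij (fun j _ => j.val - a.val - 1) ?_ ?_ ?_ ?_
    · intro j hj
      simp only [Finset.mem_Ioo, Fin.lt_def, Finset.mem_range] at hj ⊢
      omega
    · intro j hj j' hj' e
      simp only [Finset.mem_Ioo, Fin.lt_def] at hj hj'
      ext
      omega
    · intro i hi
      rw [Finset.mem_range] at hi
      refine ⟨⟨a.val + i + 1, by omega⟩, ?_, ?_⟩
      · simp only [Finset.mem_Ioo, Fin.lt_def]
        omega
      · simp only
        omega
    · intro j hj
      simp only [Finset.mem_Ioo, Fin.lt_def] at hj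
      rw [ih (j.val - a.val - 1) (by omega) a j (by omega),
        ih (m - (j.val - a.val - 1)) (by omega) j b (by omega)]

theorem mapRingHom_windingPolynomial :
    AddMonoidAlgebra.mapRingHom ℤ (Nat.castRingHom ℚ) P.windingPolynomial = checkerboardSeq n := by
  rw [← P.weightBetween_eq_checkerboardSeq 0 (Fin.last (n + 1)) n (by simp), windingPolynomial,
    weightBetween, map_sum]
  refine Finset.sum_congr ?_ fun c _ => ?_
  · ext c
    rw [mem_checkerboardsBetween, ← isCheckerboard_iff]
    simp [checkerboardTriangulations]
  · rw [LaurentPolynomial.T, AddMonoidAlgebra.mapRingHom_single, map_one, LaurentPolynomial.T]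

end MarkedPolygon

theorem theorem3 (n : ℕ) :
    (∀ P : MarkedPolygon (3 * n),
      AddMonoidAlgebra.mapRingHom ℤ (Nat.castRingHom ℚ) P.windingPolynomial =
        ∑ k ∈ Finset.range (n + 1),
          LaurentPolynomial.C
            (((4 * n - 2 * k).choose (n + k) : ℚ) * ((2 * n + 2 * k).choose (3 * k) : ℚ) /
              (3 * (k : ℚ) + 1)) *
            LaurentPolynomial.T ((n : ℤ) - 2 * (k : ℤ))) ∧
    (∀ P : MarkedPolygon (3 * n + 1),
      AddMonoidAlgebra.mapRingHom ℤ (Nat.castRingHom ℚ) P.windingPolynomial =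
        ∑ k ∈ Finset.range (n + 1),
          LaurentPolynomial.C
            (((4 * n + 2 - 2 * k).choose (n + k) : ℚ) * ((2 * n + 2 * k).choose (3 * k) : ℚ) /
              (2 * (n : ℚ) + 1 - (k : ℚ))) *
            LaurentPolynomial.T ((n : ℤ) + 1 - 2 * (k : ℤ))) ∧
    (∀ P : MarkedPolygon (3 * n + 2),
      AddMonoidAlgebra.mapRingHom ℤ (Nat.castRingHom ℚ) P.windingPolynomial =
        ∑ k ∈ Finset.range (n + 1),
          LaurentPolynomial.C
            (((4 * n + 2 - 2 * k).choose (n + 1 + k) : ℚ) *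
                ((2 * n + 2 + 2 * k).choose (3 * k + 1) : ℚ) /
              (3 * (k : ℚ) + 2)) *
            LaurentPolynomial.T ((n : ℤ) - 2 * (k : ℤ))) :=
  ⟨fun P => P.mapRingHom_windingPolynomial.trans (checkerboardSeq_three_mul n),
    fun P => P.mapRingHom_windingPolynomial.trans (checkerboardSeq_three_mul_add_one n),
    fun P => P.mapRingHom_windingPolynomial.trans (checkerboardSeq_three_mul_add_two n)⟩
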